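/- \textbf{Budgeted $\ell$-matchoid (BM).} For $\ell\ge 1$, an $\ell$-matchoid on a finite set $E$ is a family $\mathcal M=(M_i)_{i\in[s]}$ of matroids $M_i=(E_i,\mathcal I_i)$ with $E_i\subseteq E$ such that every $e\in E$ lies in $E_i$ for at most $\ell$ indices $i$. A BM instance is a tuple $I=(E,\mathcal M,c,p,B,k,\ell)$ with $\mathcal M$ an $\ell$-matchoid on $E$, costs $c:E\to\mathbb N_{>0}$, profits $p:E\to\mathbb N_{>0}$, a budget $B\in\mathbb N_{>0}$ and parameters $k,\ell\in\mathbb N_{>0}$. A solution of $I$ is a set $S\subseteq E$ with $S\cap E_i\in\mathcal I_i$ for all $i\in[s]$, $|S|\le k$ and $\sum_{e\in S}c(e)\le B$; $\mathrm{OPT}(I)$ is the maximum of $p(S)=\sum_{e\in S}p(e)$ over all solutions $S$. The independent sets of each matroid are given by a membership oracle; everything else (the ground set, the sets $E_i$ and all numbers, in binary) is given explicitly, and $|I|$ is the size of this encoding. Budgeted $\ell$-matroid intersection (BMI) is the special case $s=\ell$, $E_i=E$ for all $i$. Budgeted $\ell$-dimensional matching (BDM) is the special case of BMI where $E\subseteq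 U_1\times\dots\times U_\ell$ and $\mathcal I_i$ consists of the sets of tuples with pairwise distinct $i$-th coordinates, so that the feasible sets are the sets of tuples in which any two distinct members differ in every coordinate. \textbf{Theorem.} BM has an FPT-approximation scheme with parameters $k,\ell$ whose running time is $$|I|^{O(1)}\cdot\tilde O\!\left(\ell^{k^2\ell}\cdot k^{O(k)}\cdot\varepsilon^{-2k}\right).$$ That is, there are a single algorithm and constants $\alpha,\beta,\gamma,\delta\in\mathbb N$ such that for every BM instance $I=(E,\mathcal M,c,p,B,k,\ell)$ and every real $0<\varepsilon<\frac12$, the algorithm on input $I$ and $\varepsilon$ returns a solution $S$ of $I$ with $p(S)\ge(1-\varepsilon)\cdot\mathrm{OPT}(I)$ in time at most $$\alpha\cdot|I|^{\beta}\cdot g\cdot(\log g)^{\delta},\qquad g=\ell^{k^2\ell}\cdot k^{\gamma k}\cdot\varepsilon^{-2k}.$$ In particular, with the same algorithm and the same bound, this holds for BMI (the returned set is a common independent set of the $\ell$ matroids with at most $k$ elements and cost at most $B$, of profit at least $1-\varepsilon$ times the optimum over such sets) and for BDM (likewise for matchings). Here an algorithm is a program for a random access machine over the natural numbers with addition, truncated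 subtraction, multiplication, integer division and indirect addressing, and with the logarithmic cost measure; it accesses the matroids through independence queries ("is the set $A$ an independent subset of $E_i$?", charged $|E|$ plus the cost of the index $i$, up to a constant) and $\varepsilon$ through its binary digits (the $j$-th digit being charged $j$ plus the cost of the index $j$, up to a constant). -/

import Mathlib

namespace BudgetedMatchoid

/-! ### The problems -/

/-- An instance `(E, 𝓜, c, p, B, k, ℓ)` of the budgeted `ℓ`-matchoid problem, with the ground set
labelled as `E = {0, …, n - 1}`.  The matchoid is a family of `s` matroids; the `i`-th one has
ground set `(M i).E ⊆ E`, and every element lies in at most `ℓ` of these ground sets. -/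
structure BMInstance where
  n : ℕ
  s : ℕ
  M : Fin s → Matroid (Fin n)
  c : Fin n → ℕ
  p : Fin n → ℕ
  B : ℕ
  k : ℕ
  ℓ : ℕ
  matchoid : ∀ e : Fin n, {i : Fin s | e ∈ (M i).E}.ncard ≤ ℓ
  c_pos : ∀ e, 0 < c e
  p_pos : ∀ e, 0 < p e
  B_pos : 0 < B
  k_pos : 0 < k
  ℓ_pos : 0 < ℓ

/-- `S` is feasible for the matchoid: `S ∩ Eᵢ` is independent in the `i`-th matroid for all `i`. -/
def BMInstance.IsFeasible (I : BMInstance) (S : Finset (Fin I.n)) : Prop :=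
  ∀ i : Fin I.s, (I.M i).Indep ((S : Set (Fin I.n)) ∩ (I.M i).E)

/-- Solutions: feasible sets of at most `k` elements and of cost at most `B`. -/
def BMInstance.IsSolution (I : BMInstance) (S : Finset (Fin I.n)) : Prop :=
  I.IsFeasible S ∧ S.card ≤ I.k ∧ ∑ e ∈ S, I.c e ≤ I.B

open Classical in
/-- The largest profit `p(S)` of a set `S` with the property `sol`. -/
noncomputable def opt {n : ℕ} (p : Fin n → ℕ) (sol : Finset (Fin n) → Prop) : ℕ :=
  (Finset.univ.filter sol).sup (fun S => ∑ e ∈ S, p e)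

/-- Encoding size of an instance: the ground set and the index set of the matroids are listed,
the sets `Eᵢ` are given by their `s × n` incidence matrix, and all numbers are in binary. -/
def BMInstance.size (I : BMInstance) : ℕ :=
  I.n + I.s + I.s * I.n + ∑ e, (I.c e).size + ∑ e, (I.p e).size
    + I.B.size + I.k.size + I.ℓ.size

/-- An instance of budgeted `ℓ`-matroid intersection: `ℓ` matroids on the same ground set. -/
structure BMIInstance where
  n : ℕ
  ℓ : ℕ
  M : Fin ℓ → Matroid (Fin n)
  ground : ∀ i, (M i).E = Set.univ
  c : Fin n → ℕ
  p : Fin n → ℕ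
  B : ℕ
  k : ℕ
  c_pos : ∀ e, 0 < c e
  p_pos : ∀ e, 0 < p e
  B_pos : 0 < B
  k_pos : 0 < k
  ℓ_pos : 0 < ℓ

/-- Solutions: common independent sets of at most `k` elements and of cost at most `B`. -/
def BMIInstance.IsSolution (J : BMIInstance) (S : Finset (Fin J.n)) : Prop :=
  (∀ i, (J.M i).Indep (S : Set (Fin J.n))) ∧ S.card ≤ J.k ∧ ∑ e ∈ S, J.c e ≤ J.B

theorem ncard_le_of_fin {ℓ : ℕ} (A : Set (Fin ℓ)) : A.ncard ≤ ℓ := by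
  simpa using Set.ncard_le_card A

/-- Matroid intersection as the special case `s = ℓ`, `Eᵢ = E` of a matchoid. -/
abbrev BMIInstance.toBM (J : BMIInstance) : BMInstance where
  n := J.n
  s := J.ℓ
  M := J.M
  c := J.c
  p := J.p
  B := J.B
  k := J.k
  ℓ := J.ℓ
  matchoid := fun _ => ncard_le_of_fin _
  c_pos := J.c_pos
  p_pos := J.p_pos
  B_pos := J.B_pos
  k_pos := J.k_pos
  ℓ_pos := J.ℓ_pos

universe u

/-- An instance of budgeted `ℓ`-dimensional matching: a set of `n` distinct tuples in
`U₁ × ⋯ × U_ℓ` with costs, profits, a budget and a bound `k` on the cardinality. -/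
structure BDMInstance where
  n : ℕ
  ℓ : ℕ
  U : Fin ℓ → Type u
  tuple : Fin n → (i : Fin ℓ) → U i
  tuple_injective : Function.Injective tuple
  c : Fin n → ℕ
  p : Fin n → ℕ
  B : ℕ
  k : ℕ
  c_pos : ∀ e, 0 < c e
  p_pos : ∀ e, 0 < p e
  B_pos : 0 < B
  k_pos : 0 < k
  ℓ_pos : 0 < ℓ

/-- Solutions: matchings (distinct members differ in every coordinate) of at most `k` tuples and
of cost at most `B`. -/
def BDMInstance.IsSolution (J : BDMInstance.{u}) (S : Finset (Fin J.n)) : Prop :=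
  (∀ e ∈ S, ∀ f ∈ S, e ≠ f → ∀ i, J.tuple e i ≠ J.tuple f i) ∧
    S.card ≤ J.k ∧ ∑ e ∈ S, J.c e ≤ J.B

/-- The partition matroid of the `i`-th coordinate: a set of tuples is independent when the `i`-th
coordinate is injective on it. -/
def BDMInstance.partitionMatroid (J : BDMInstance.{u}) (i : Fin J.ℓ) : Matroid (Fin J.n) :=
  (Matroid.freeOn (Set.univ : Set (J.U i))).comap (fun e => J.tuple e i)

/-- Dimensional matching as matroid intersection. -/
abbrev BDMInstance.toBMI (J : BDMInstance.{u}) : BMIInstance where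
  n := J.n
  ℓ := J.ℓ
  M := J.partitionMatroid
  ground := fun i => by simp [BDMInstance.partitionMatroid]
  c := J.c
  p := J.p
  B := J.B
  k := J.k
  c_pos := J.c_pos
  p_pos := J.p_pos
  B_pos := J.B_pos
  k_pos := J.k_pos
  ℓ_pos := J.ℓ_pos

/-! ### The machine model

Structured programs for a random access machine over the natural numbers, with the logarithmic cost
measure: each operation is charged one unit plus the binary lengths of the numbers and addresses
that it handles.  The memory consists of registers and of arrays, both numbered by `ℕ` (a program
mentions finitely many of them).  The matroids are accessible through membership queries only, and
the error parameter, a real number, through its binary digits. -/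

/-- Memory: register `x` holds `reg x`, cell `i` of array `a` holds `arr a i`. -/
structure Mem where
  reg : ℕ → ℕ
  arr : ℕ → ℕ → ℕ

/-- Arithmetic expressions; `sub` is truncated and `div` is integer division. -/
inductive AExp : Type
  | lit (v : ℕ)
  | reg (x : ℕ)
  | arr (a : ℕ) (i : AExp)
  | add (e f : AExp)
  | sub (e f : AExp)
  | mul (e f : AExp)
  | div (e f : AExp)

/-- Value of an expression. -/
def AExp.eval (σ : Mem) : AExp → ℕ
  | lit v => v
  | reg x => σ.reg x
  | arr a i => σ.arr a (i.eval σ)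
  | add e f => e.eval σ + f.eval σ
  | sub e f => e.eval σ - f.eval σ
  | mul e f => e.eval σ * f.eval σ
  | div e f => e.eval σ / f.eval σ

/-- Logarithmic cost of evaluating an expression: every node is charged one unit plus the binary
length of its value.  (So operands, and addresses of array cells, are charged as subexpressions.) -/
def AExp.cost (σ : Mem) : AExp → ℕ
  | lit v => 1 + v.size
  | reg x => 1 + (σ.reg x).size
  | arr a i => i.cost σ + 1 + (σ.arr a (i.eval σ)).size
  | add e f => e.cost σ + f.cost σ + 1 + (e.eval σ + f.eval σ).size
  | sub e f => e.cost σ + f.cost σ + 1 + (e.eval σ - f.eval σ).size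
  | mul e f => e.cost σ + f.cost σ + 1 + (e.eval σ * f.eval σ).size
  | div e f => e.cost σ + f.cost σ + 1 + (e.eval σ / f.eval σ).size

/-- Programs. -/
inductive Prog : Type
  | skip
  /-- register `x` := value of `e` -/
  | assign (x : ℕ) (e : AExp)
  /-- cell `i` of array `a` := value of `e` -/
  | store (a : ℕ) (i e : AExp)
  /-- register `x` := answer to the query whether the set with indicator vector in array `a` is
  independent in the matroid number `i` -/
  | query (x : ℕ) (i : AExp) (a : ℕ)
  /-- register `x` := `j`-th binary digit of the error parameter -/
  | digit (x : ℕ) (j : AExp)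
  | seq (P Q : Prog)
  | ite (e : AExp) (P Q : Prog)
  | loop (e : AExp) (P : Prog)

/-- Overwrite a register. -/
def Mem.setReg (σ : Mem) (x v : ℕ) : Mem :=
  { σ with reg := Function.update σ.reg x v }

/-- Overwrite an array cell. -/
def Mem.setArr (σ : Mem) (a i v : ℕ) : Mem :=
  { σ with arr := Function.update σ.arr a (Function.update (σ.arr a) i v) }

/-- The set of elements whose cell in array `a` is nonzero. -/
def Mem.toSet (σ : Mem) (a n : ℕ) : Finset (Fin n) :=
  Finset.univ.filter (fun e : Fin n => σ.arr a e ≠ 0)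

open Classical in
/-- Membership oracle: answers `1` if `i` is the number of a matroid and `S` is an independent
subset of its ground set, and `0` otherwise. -/
noncomputable def BMInstance.oracle (I : BMInstance) (i : ℕ) (S : Finset (Fin I.n)) : ℕ :=
  if ∃ h : i < I.s, (I.M ⟨i, h⟩).Indep (S : Set (Fin I.n)) then 1 else 0

/-- The digit of weight `2⁻ʲ` in the binary expansion of `ε`. -/
noncomputable def binaryDigit (ε : ℝ) (j : ℕ) : ℕ := ⌊ε * 2 ^ j⌋₊ % 2

/-- `Run I ε P σ t σ'`: with the oracles of `I` and `ε`, the program `P` started in memory `σ`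
halts in memory `σ'` after time `t`.  An independence query costs `n + 1` units besides the cost of
its index expression, and the `j`-th digit costs `j + 1` units besides that of `j`.
A loop repeats its body as long as its guard is nonzero. -/
inductive Run (I : BMInstance) (ε : ℝ) : Prog → Mem → ℕ → Mem → Prop
  | skip (σ : Mem) : Run I ε .skip σ 1 σ
  | assign (σ : Mem) (x : ℕ) (e : AExp) :
      Run I ε (.assign x e) σ (1 + e.cost σ) (σ.setReg x (e.eval σ))
  | store (σ : Mem) (a : ℕ) (i e : AExp) :
      Run I ε (.store a i e) σ (1 + i.cost σ + e.cost σ) (σ.setArr a (i.eval σ) (e.eval σ))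
  | query (σ : Mem) (x : ℕ) (i : AExp) (a : ℕ) :
      Run I ε (.query x i a) σ (1 + i.cost σ + I.n)
        (σ.setReg x (I.oracle (i.eval σ) (σ.toSet a I.n)))
  | digit (σ : Mem) (x : ℕ) (j : AExp) :
      Run I ε (.digit x j) σ (1 + j.cost σ + j.eval σ)
        (σ.setReg x (binaryDigit ε (j.eval σ)))
  | seq {P Q : Prog} {σ σ' σ'' : Mem} {t t' : ℕ} :
      Run I ε P σ t σ' → Run I ε Q σ' t' σ'' → Run I ε (.seq P Q) σ (t + t') σ''
  | ite_true {e : AExp} {P Q : Prog} {σ σ' : Mem} {t : ℕ} :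
      e.eval σ ≠ 0 → Run I ε P σ t σ' → Run I ε (.ite e P Q) σ (1 + e.cost σ + t) σ'
  | ite_false {e : AExp} {P Q : Prog} {σ σ' : Mem} {t : ℕ} :
      e.eval σ = 0 → Run I ε Q σ t σ' → Run I ε (.ite e P Q) σ (1 + e.cost σ + t) σ'
  | loop_done {e : AExp} {P : Prog} {σ : Mem} :
      e.eval σ = 0 → Run I ε (.loop e P) σ (1 + e.cost σ) σ
  | loop_step {e : AExp} {P : Prog} {σ σ' σ'' : Mem} {t t' : ℕ} :
      e.eval σ ≠ 0 → Run I ε P σ t σ' → Run I ε (.loop e P) σ' t' σ'' →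
        Run I ε (.loop e P) σ (1 + e.cost σ + t + t') σ''

/-- Running time and result of a halting program are determined by its input. -/
theorem Run.deterministic {I : BMInstance} {ε : ℝ} {P : Prog} {σ σ₁ σ₂ : Mem} {t₁ t₂ : ℕ}
    (h₁ : Run I ε P σ t₁ σ₁) (h₂ : Run I ε P σ t₂ σ₂) : t₁ = t₂ ∧ σ₁ = σ₂ := by
  induction h₁ generalizing t₂ σ₂ with
  | skip | assign | store | query | digit => cases h₂; exact ⟨rfl, rfl⟩
  | seq _ _ ih ih' =>
    cases h₂ with
    | seq a b =>
      obtain ⟨rfl, rfl⟩ := ih a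
      obtain ⟨rfl, rfl⟩ := ih' b
      exact ⟨rfl, rfl⟩
  | ite_true h _ ih =>
    cases h₂ with
    | ite_true _ a => obtain ⟨rfl, rfl⟩ := ih a; exact ⟨rfl, rfl⟩
    | ite_false h' _ => exact absurd h' h
  | ite_false h _ ih =>
    cases h₂ with
    | ite_true h' _ => exact absurd h h'
    | ite_false _ a => obtain ⟨rfl, rfl⟩ := ih a; exact ⟨rfl, rfl⟩
  | loop_done h =>
    cases h₂ with
    | loop_done _ => exact ⟨rfl, rfl⟩
    | loop_step h' _ _ => exact absurd h h'
  | loop_step h _ _ ih ih' =>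
    cases h₂ with
    | loop_done h' => exact absurd h' h
    | loop_step _ a b =>
      obtain ⟨rfl, rfl⟩ := ih a
      obtain ⟨rfl, rfl⟩ := ih' b
      exact ⟨rfl, rfl⟩

open Classical in
/-- Initial memory: registers `0, …, 4` hold `n, s, k, ℓ, B`; arrays `1` and `2` hold the costs and
the profits; cell `i * n + e` of array `3` is `1` if element `e` belongs to the ground set of the
`i`-th matroid; everything else is `0`. -/
noncomputable def BMInstance.init (I : BMInstance) : Mem where
  reg := fun x => match x with
    | 0 => I.n
    | 1 => I.s
    | 2 => I.k
    | 3 => I.ℓ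
    | 4 => I.B
    | _ => 0
  arr := fun a j => match a with
    | 1 => if h : j < I.n then I.c ⟨j, h⟩ else 0
    | 2 => if h : j < I.n then I.p ⟨j, h⟩ else 0
    | 3 => if ∃ (i : Fin I.s) (e : Fin I.n), j = i * I.n + e ∧ e ∈ (I.M i).E then 1 else 0
    | _ => 0

/-- On input `I` and `ε`, the program `P` halts within time `T`, and the set `S` whose indicator
vector it leaves in array `0` satisfies `sol` and has profit at least `(1 - ε)` times the largest
profit of a set that satisfies `sol`. -/
def Approximates (P : Prog) (I : BMInstance) (ε : ℝ) (sol : Finset (Fin I.n) → Prop) (T : ℝ) :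
    Prop :=
  ∃ (t : ℕ) (σ : Mem), Run I ε P I.init t σ ∧ (t : ℝ) ≤ T ∧
    sol (σ.toSet 0 I.n) ∧
    (1 - ε) * (opt I.p sol : ℝ) ≤ ((∑ e ∈ σ.toSet 0 I.n, I.p e : ℕ) : ℝ)

/-- The expression `ℓ ^ (k² ℓ) * k ^ (γ k) * ε ^ (-2 k)`. -/
noncomputable def paramBound (γ : ℕ) (k ℓ : ℕ) (ε : ℝ) : ℝ :=
  (ℓ : ℝ) ^ (k ^ 2 * ℓ) * (k : ℝ) ^ (γ * k) * ε⁻¹ ^ (2 * k)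

/-- The running time `α * |I| ^ β * (g * (log g) ^ δ)` with
`g = ℓ ^ (k² ℓ) * k ^ (γ k) * ε ^ (-2 k)`. -/
noncomputable def timeBound (α β γ δ : ℕ) (I : BMInstance) (ε : ℝ) : ℝ :=
  α * (I.size : ℝ) ^ β *
    (paramBound γ I.k I.ℓ ε * Real.log (paramBound γ I.k I.ℓ ε) ^ δ)

end BudgetedMatchoid

/-! Guess the most profitable element `e₀` of an optimal solution, shrink the ground set to a short
list of representatives, and search all subsets of the list with at most `k` elements by brute
force. Let `Q = 2 ^ j`, where `j` is the position of the first nonzero binary digit of `ε`; then `1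
/ ε ≤ Q ≤ 2 / ε`. Elements fall into classes `⌊p(e) k Q / p(e₀)⌋`, and those no more profitable than
`e₀` have a class in `{0, …, k Q}`. Exchanging at most `k` elements within their classes costs at
most `p(e₀) / Q ≤ ε OPT` in profit.

It remains to find, for each class, a small set that contains for every feasible `S` with at most
`k` elements and every `e ∈ S` of that class a substitute `x` of the same class, no more expensive
than `e`, with `S - e + x` feasible and `x ∉ S - e`. A search tree does this. Each node carries one
independent set per matroid (the rows of a table) and an extra row `s` for elements that lie in no
matroid. The node picks the cheapest element of the class that can be added to the rows of all
matroids containing it; its children add that element to the row of one of these at most `ℓ`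
matroids. Follow a branch on which row `i` stays inside the closure of `(S - e) ∩ Eᵢ`. Then `e`
itself remains a candidate (`alive_of_spanned`), so the picked `x` costs at most `c(e)`. If `x` is
no substitute, it is spanned by `S - e` in some matroid, or it belongs to `S - e` and to no matroid,
so some child continues the branch (`exists_child`). As each row is an independent set spanned by
`(S - e) ∩ Eᵢ`, the table never holds more than `(k - 1) ℓ` elements (`Spanned.le`), and the branch
must succeed by that depth (`exists_substitute`).

The list thus has at most `m = (k Q + 1) ℓ ^ ((k - 1) ℓ) ((k - 1) ℓ + 1)` entries, and `m ^ k`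
tuples are tested; `maxLen_pow_le` bounds `m ^ k` by a multiple of `g`. The remaining factors are
polynomial in `|I|`, `k`, `ℓ` and the bit length of `m ^ k`. Since `k` and `ℓ` enter `|I|` only
through their binary lengths, their polynomial factors are charged to powers of `log g`.

For the machine, `Wp` is a Hoare-style total correctness statement that counts elementary
operations, all numbers in memory being bounded by one `V`; `unitCost` then turns the count into
logarithmic cost. -/

namespace BudgetedMatchoid

/-! ### A calculus for bounded runs -/

/-- All memory cells hold numbers of size at most `V`. -/
def Mem.Bdd (V : ℕ) (σ : Mem) : Prop :=
  2 ≤ V ∧ (∀ x, σ.reg x ≤ V) ∧ ∀ a i, σ.arr a i ≤ V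

/-- Number of nodes of an expression, a literal `v` counting `v + 1`. -/
def AExp.weight : AExp → ℕ
  | lit v => v + 1
  | reg _ => 1
  | arr _ i => i.weight + 1
  | add e f => e.weight + f.weight + 1
  | sub e f => e.weight + f.weight + 1
  | mul e f => e.weight + f.weight + 1
  | div e f => e.weight + f.weight + 1

theorem AExp.weight_pos (e : AExp) : 0 < e.weight := by
  cases e <;> simp [AExp.weight]

/-- A sum at most doubles the larger operand bound, and `2 ≤ V` pays for the doubling with the extra
unit of weight; products add the exponents. A literal `v` needs weight `v + 1` because the only
bound available for it is `v ≤ 2 ^ v`. -/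
theorem AExp.eval_le_pow {V : ℕ} {σ : Mem} (h : σ.Bdd V) (e : AExp) :
    e.eval σ ≤ V ^ e.weight := by
  obtain ⟨hV, hr, ha⟩ := h
  have key : ∀ a b x y : ℕ, x ≤ V ^ a → y ≤ V ^ b → x + y ≤ V ^ (a + b + 1) := by
    intro a b x y hx hy
    have h1 : V ^ a ≤ V ^ (a + b) := Nat.pow_le_pow_right (by omega) (by omega)
    have h2 : V ^ b ≤ V ^ (a + b) := Nat.pow_le_pow_right (by omega) (by omega)
    calc x + y ≤ 2 * V ^ (a + b) := by omega
      _ ≤ V * V ^ (a + b) := Nat.mul_le_mul_right _ hV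
      _ = _ := by ring
  induction e with
  | lit v =>
    calc v ≤ 2 ^ v := Nat.lt_two_pow_self.le
      _ ≤ V ^ v := Nat.pow_le_pow_left hV _
      _ ≤ V ^ (v + 1) := Nat.pow_le_pow_right (by omega) (by omega)
  | reg x => simpa [AExp.eval, AExp.weight] using hr x
  | arr a i ih =>
    exact (ha a _).trans (Nat.le_self_pow (by simp [AExp.weight]) _)
  | add e f ihe ihf => exact key _ _ _ _ ihe ihf
  | sub e f ihe ihf =>
    exact (Nat.sub_le _ _).trans ((Nat.le_add_right _ _).trans (key _ _ _ _ ihe ihf))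
  | mul e f ihe ihf =>
    calc e.eval σ * f.eval σ ≤ V ^ e.weight * V ^ f.weight := Nat.mul_le_mul ihe ihf
      _ = V ^ (e.weight + f.weight) := by ring
      _ ≤ _ := Nat.pow_le_pow_right (by omega) (by simp [AExp.weight])
  | div e f ihe ihf =>
    exact (Nat.div_le_self _ _).trans ((Nat.le_add_right _ _).trans (key _ _ _ _ ihe ihf))

theorem size_pow_le (V w : ℕ) (hw : 0 < w) : (V ^ w).size ≤ w * V.size := by
  rw [Nat.size_le, mul_comm, pow_mul]
  exact Nat.pow_lt_pow_left (Nat.lt_size_self V) hw.ne'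

/-- Each node costs one unit plus the length of its value, and that value is at most `V ^ w`. The
bound `w` is kept apart from the weight so that it stays fixed in the induction. -/
theorem AExp.cost_le {V : ℕ} {σ : Mem} (h : σ.Bdd V) (e : AExp) (w : ℕ) (hw : e.weight ≤ w) :
    e.cost σ ≤ e.weight * (1 + w * V.size) := by
  have key : ∀ f : AExp, f.weight ≤ w → (f.eval σ).size ≤ w * V.size := fun f hf =>
    (Nat.size_le_size (f.eval_le_pow h)).trans
      ((size_pow_le _ _ f.weight_pos).trans (Nat.mul_le_mul_right _ hf))
  have hb : ∀ (e f : AExp) (x : ℕ), e.cost σ ≤ e.weight * (1 + w * V.size) →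
      f.cost σ ≤ f.weight * (1 + w * V.size) → x ≤ w * V.size →
      e.cost σ + f.cost σ + 1 + x ≤ (e.weight + f.weight + 1) * (1 + w * V.size) := by
    intro e f x h1 h2 h3
    have : (e.weight + f.weight + 1) * (1 + w * V.size) =
      e.weight * (1 + w * V.size) + f.weight * (1 + w * V.size) + (1 + w * V.size) := by ring
    omega
  induction e with
  | lit v =>
    have := key _ hw
    have h2 : 1 + v.size ≤ 1 + w * V.size := by simpa [AExp.eval] using this
    exact h2.trans (Nat.le_mul_of_pos_left _ (by simp [AExp.weight]))
  | reg x =>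
    have := key _ hw
    simpa [AExp.cost, AExp.weight, AExp.eval] using this
  | arr a i ih =>
    have h1 := key _ hw
    have h2 := ih (by simp [AExp.weight] at hw; omega)
    simp only [AExp.cost, AExp.weight, AExp.eval] at *
    have : (i.weight + 1) * (1 + w * V.size) = i.weight * (1 + w * V.size) + (1 + w * V.size) := by
      ring
    omega
  | add e f ihe ihf | sub e f ihe ihf | mul e f ihe ihf | div e f ihe ihf =>
    have h1 := key _ hw
    simp only [AExp.weight] at hw
    exact hb e f _ (ihe (by omega)) (ihf (by omega)) h1

/-- Bound for the cost of one elementary operation, `J` bounding the digit positions. -/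
def unitCost (I : BMInstance) (V J : ℕ) : ℕ := 4000 * V.size + I.n + J + 1

/-- Twice the cost, because a `store` evaluates two expressions: `2 * 40 * (1 + 40 * V.size) ≤ 4000
* V.size`. -/
theorem AExp.two_cost_le {V : ℕ} {σ : Mem} (h : σ.Bdd V) (e : AExp) (hw : e.weight ≤ 40) :
    2 * e.cost σ ≤ 4000 * V.size := by
  have h1 := e.cost_le h 40 hw
  have h2 : e.weight * (1 + 40 * V.size) ≤ 40 * (1 + 40 * V.size) := Nat.mul_le_mul_right _ hw
  have h3 : 0 < V.size := Nat.size_pos.2 (by have := h.1; omega)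
  omega

/-- May the program write to register `x`? -/
def Prog.writesReg (x : ℕ) : Prog → Bool
  | skip => false
  | assign y _ => x == y
  | store _ _ _ => false
  | query y _ _ => x == y
  | digit y _ => x == y
  | seq P Q => P.writesReg x || Q.writesReg x
  | ite _ P Q => P.writesReg x || Q.writesReg x
  | loop _ P => P.writesReg x

/-- May the program write to array `a`? -/
def Prog.writesArr (a : ℕ) : Prog → Bool
  | store b _ _ => a == b
  | seq P Q => P.writesArr a || Q.writesArr a
  | ite _ P Q => P.writesArr a || Q.writesArr a
  | loop _ P => P.writesArr a
  | _ => false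

/-- `τ` agrees with `σ` on everything that `P` does not write. -/
structure Frame (P : Prog) (σ τ : Mem) : Prop where
  reg : ∀ x, P.writesReg x = false → τ.reg x = σ.reg x
  arr : ∀ a, P.writesArr a = false → τ.arr a = σ.arr a

theorem Frame.refl (P : Prog) (σ : Mem) : Frame P σ σ := ⟨fun _ _ => rfl, fun _ _ => rfl⟩

theorem Frame.trans {P : Prog} {σ τ υ : Mem} (h : Frame P σ τ) (h' : Frame P τ υ) :
    Frame P σ υ :=
  ⟨fun x hx => (h'.reg x hx).trans (h.reg x hx), fun a ha => (h'.arr a ha).trans (h.arr a ha)⟩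

theorem Frame.of_subprog {P P' : Prog} {σ τ : Mem} (h : Frame P σ τ)
    (hr : ∀ x, P'.writesReg x = false → P.writesReg x = false)
    (ha : ∀ a, P'.writesArr a = false → P.writesArr a = false) : Frame P' σ τ :=
  ⟨fun x hx => h.reg x (hr x hx), fun a hx => h.arr a (ha a hx)⟩

@[simp] theorem Mem.setReg_reg (σ : Mem) (x v y : ℕ) :
    (σ.setReg x v).reg y = if y = x then v else σ.reg y := by
  simp [Mem.setReg, Function.update_apply]

@[simp] theorem Mem.setReg_arr (σ : Mem) (x v : ℕ) : (σ.setReg x v).arr = σ.arr := rfl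

@[simp] theorem Mem.setArr_reg (σ : Mem) (a i v : ℕ) : (σ.setArr a i v).reg = σ.reg := rfl

@[simp] theorem Mem.setArr_arr (σ : Mem) (a i v b : ℕ) :
    (σ.setArr a i v).arr b = if b = a then Function.update (σ.arr a) i v else σ.arr b := by
  simp [Mem.setArr, Function.update_apply]

/-- The write sets are computed from the syntax, so that a concrete program leaves a concrete
register or array alone by `rfl` or `decide`. Specifications therefore mention only what changes. -/
theorem Run.frame {I : BMInstance} {ε : ℝ} {P : Prog} {σ τ : Mem} {t : ℕ}
    (h : Run I ε P σ t τ) : Frame P σ τ := by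
  induction h with
  | skip σ => exact Frame.refl _ _
  | assign σ x e | query σ x i a | digit σ x j =>
    refine ⟨fun y hy => ?_, fun _ _ => rfl⟩
    simp only [Prog.writesReg, beq_eq_false_iff_ne] at hy
    simp [hy]
  | store σ a i e =>
    refine ⟨fun _ _ => rfl, fun b hb => ?_⟩
    simp only [Prog.writesArr, beq_eq_false_iff_ne] at hb
    simp [hb]
  | seq _ _ ih ih' =>
    refine Frame.trans (ih.of_subprog ?_ ?_) (ih'.of_subprog ?_ ?_) <;>
      simp +contextual [Prog.writesReg, Prog.writesArr]
  | ite_true _ _ ih | ite_false _ _ ih =>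
    refine ih.of_subprog ?_ ?_ <;> simp +contextual [Prog.writesReg, Prog.writesArr]
  | loop_done => exact Frame.refl _ _
  | loop_step _ _ _ ih ih' =>
    exact Frame.trans (ih.of_subprog (fun _ h => h) (fun _ h => h)) ih'

/-- Started in the bounded memory `σ`, the program `P` halts after at most `N` elementary
operations in a bounded memory that satisfies `Q`. -/
def Wp (I : BMInstance) (ε : ℝ) (V J : ℕ) (P : Prog) (N : ℕ) (σ : Mem) (Q : Mem → Prop) : Prop :=
  σ.Bdd V → ∃ t τ, Run I ε P σ t τ ∧ t ≤ N * unitCost I V J ∧ τ.Bdd V ∧ Q τ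

theorem Mem.Bdd.setReg {V : ℕ} {σ : Mem} (h : σ.Bdd V) {x v : ℕ} (hv : v ≤ V) :
    (σ.setReg x v).Bdd V := by
  refine ⟨h.1, fun y => ?_, h.2.2⟩
  rw [Mem.setReg_reg]
  split_ifs
  · exact hv
  · exact h.2.1 y

theorem Mem.Bdd.setArr {V : ℕ} {σ : Mem} (h : σ.Bdd V) {a i v : ℕ} (hv : v ≤ V) :
    (σ.setArr a i v).Bdd V := by
  refine ⟨h.1, h.2.1, fun b j => ?_⟩
  rw [Mem.setArr_arr]
  split_ifs
  · rw [Function.update_apply]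
    split_ifs
    · exact hv
    · exact h.2.2 a j
  · exact h.2.2 b j

section Rules

variable {I : BMInstance} {ε : ℝ} {V J : ℕ} {P P' : Prog} {N N' : ℕ} {σ : Mem} {Q R : Mem → Prop}

theorem Wp.mono (h : Wp I ε V J P N σ R) (hN : N ≤ N')
    (hQ : ∀ τ, τ.Bdd V → Frame P σ τ → R τ → Q τ) : Wp I ε V J P N' σ Q := by
  intro hb
  obtain ⟨t, τ, hr, ht, hτ, hR⟩ := h hb
  exact ⟨t, τ, hr, ht.trans (Nat.mul_le_mul_right _ hN), hτ, hQ τ hτ hr.frame hR⟩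

theorem Wp.le (h : Wp I ε V J P N σ Q) (hN : N ≤ N') : Wp I ε V J P N' σ Q :=
  h.mono hN fun _ _ _ h => h

theorem Wp.of_bdd (h : σ.Bdd V → Wp I ε V J P N σ Q) : Wp I ε V J P N σ Q :=
  fun hb => h hb hb

theorem Wp.skip (hQ : Q σ) : Wp I ε V J .skip 1 σ Q := by
  intro hb
  refine ⟨1, σ, Run.skip σ, ?_, hb, hQ⟩
  simp [unitCost]

theorem Wp.assign {x : ℕ} {e : AExp} (hw : e.weight ≤ 40) (hv : σ.Bdd V → e.eval σ ≤ V)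
    (hQ : Q (σ.setReg x (e.eval σ))) : Wp I ε V J (.assign x e) 1 σ Q := by
  intro hb
  refine ⟨_, _, Run.assign σ x e, ?_, hb.setReg (hv hb), hQ⟩
  have := e.two_cost_le hb hw
  simp only [unitCost]
  omega

theorem Wp.store {a : ℕ} {i e : AExp} (hi : i.weight ≤ 40) (he : e.weight ≤ 40)
    (hv : σ.Bdd V → e.eval σ ≤ V)
    (hQ : Q (σ.setArr a (i.eval σ) (e.eval σ))) : Wp I ε V J (.store a i e) 1 σ Q := by
  intro hb
  refine ⟨_, _, Run.store σ a i e, ?_, hb.setArr (hv hb), hQ⟩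
  have := e.two_cost_le hb he
  have := i.two_cost_le hb hi
  simp only [unitCost]
  omega

theorem BMInstance.oracle_le_one (I : BMInstance) (i : ℕ) (S : Finset (Fin I.n)) :
    I.oracle i S ≤ 1 := by
  unfold BMInstance.oracle
  split_ifs <;> omega

theorem Wp.query {x a : ℕ} {i : AExp} (hi : i.weight ≤ 40)
    (hQ : Q (σ.setReg x (I.oracle (i.eval σ) (σ.toSet a I.n)))) :
    Wp I ε V J (.query x i a) 1 σ Q := by
  intro hb
  refine ⟨_, _, Run.query σ x i a, ?_, hb.setReg ?_, hQ⟩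
  · have := i.two_cost_le hb hi
    simp only [unitCost]
    omega
  · exact (I.oracle_le_one _ _).trans (by have := hb.1; omega)

theorem Wp.digit {x : ℕ} {j : AExp} (hj : j.weight ≤ 40) (hJ : j.eval σ ≤ J)
    (hQ : Q (σ.setReg x (binaryDigit ε (j.eval σ)))) :
    Wp I ε V J (.digit x j) 1 σ Q := by
  intro hb
  refine ⟨_, _, Run.digit σ x j, ?_, hb.setReg ?_, hQ⟩
  · have := j.two_cost_le hb hj
    simp only [unitCost]
    omega
  · have := hb.1
    unfold binaryDigit
    omega

theorem Wp.seq (h : Wp I ε V J P N σ R)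
    (h' : ∀ τ, Frame P σ τ → R τ → Wp I ε V J P' N' τ Q) :
    Wp I ε V J (.seq P P') (N + N') σ Q := by
  intro hb
  obtain ⟨t, τ, hr, ht, hτ, hR⟩ := h hb
  obtain ⟨t', τ', hr', ht', hτ', hR'⟩ := h' τ hr.frame hR hτ
  refine ⟨_, _, hr.seq hr', ?_, hτ', hR'⟩
  rw [add_mul]
  exact add_le_add ht ht'

theorem Wp.seq_assign {x : ℕ} {e : AExp} (hw : e.weight ≤ 40) (hv : σ.Bdd V → e.eval σ ≤ V)
    (h : Wp I ε V J P N (σ.setReg x (e.eval σ)) Q) :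
    Wp I ε V J (.seq (.assign x e) P) (1 + N) σ Q :=
  Wp.seq (R := fun τ => τ = σ.setReg x (e.eval σ)) (.assign hw hv rfl) (by rintro _ _ rfl; exact h)

theorem Wp.seq_store {a : ℕ} {i e : AExp} (hi : i.weight ≤ 40) (he : e.weight ≤ 40)
    (hv : σ.Bdd V → e.eval σ ≤ V)
    (h : Wp I ε V J P N (σ.setArr a (i.eval σ) (e.eval σ)) Q) :
    Wp I ε V J (.seq (.store a i e) P) (1 + N) σ Q :=
  Wp.seq (R := fun τ => τ = σ.setArr a (i.eval σ) (e.eval σ)) (.store hi he hv rfl)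
    (by rintro _ _ rfl; exact h)

theorem Wp.seq_query {x a : ℕ} {i : AExp} (hi : i.weight ≤ 40)
    (h : Wp I ε V J P N (σ.setReg x (I.oracle (i.eval σ) (σ.toSet a I.n))) Q) :
    Wp I ε V J (.seq (.query x i a) P) (1 + N) σ Q :=
  Wp.seq (R := fun τ => τ = σ.setReg x (I.oracle (i.eval σ) (σ.toSet a I.n))) (.query hi rfl)
    (by rintro _ _ rfl; exact h)

/-- The sum of the two branch counts stands in for their maximum; this costs a constant factor and
avoids case distinctions in the counts. -/
theorem Wp.ite {e : AExp} (he : e.weight ≤ 40) (h1 : e.eval σ ≠ 0 → Wp I ε V J P N σ Q)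
    (h0 : e.eval σ = 0 → Wp I ε V J P' N' σ Q) :
    Wp I ε V J (.ite e P P') (1 + (N + N')) σ Q := by
  intro hb
  have hc := e.two_cost_le hb he
  have hu : 1 + e.cost σ ≤ unitCost I V J := by simp only [unitCost]; omega
  by_cases h : e.eval σ = 0
  · obtain ⟨t, τ, hr, ht, hτ, hR⟩ := h0 h hb
    exact ⟨_, _, hr.ite_false h, by rw [add_mul, one_mul, add_mul]; omega, hτ, hR⟩
  · obtain ⟨t, τ, hr, ht, hτ, hR⟩ := h1 h hb
    exact ⟨_, _, hr.ite_true h, by rw [add_mul, one_mul, add_mul]; omega, hτ, hR⟩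

theorem Wp.loop_done {e : AExp} (he : e.weight ≤ 40) (h : e.eval σ = 0) (hQ : Q σ) :
    Wp I ε V J (.loop e P) 1 σ Q := by
  intro hb
  refine ⟨_, _, Run.loop_done h, ?_, hb, hQ⟩
  have hc := e.two_cost_le hb he
  simp only [unitCost]; omega

theorem Wp.loop_step {e : AExp} (he : e.weight ≤ 40) (h : e.eval σ ≠ 0)
    (hP : Wp I ε V J P N σ R)
    (h' : ∀ τ, Frame P σ τ → R τ → Wp I ε V J (.loop e P) N' τ Q) :
    Wp I ε V J (.loop e P) (1 + N + N') σ Q := by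
  intro hb
  have hc := e.two_cost_le hb he
  have hu : 1 + e.cost σ ≤ unitCost I V J := by simp only [unitCost]; omega
  obtain ⟨t, τ, hr, ht, hτ, hR⟩ := hP hb
  obtain ⟨t', τ', hr', ht', hτ', hR'⟩ := h' τ hr.frame hR hτ
  refine ⟨_, _, hr.loop_step h hr', ?_, hτ', hR'⟩
  rw [add_mul, add_mul, one_mul]
  omega

/-- Run `P` with register `x` holding `0, 1, …` up to the value of register `y` (exclusive). -/
def forP (x y : ℕ) (P : Prog) : Prog :=
  .seq (.assign x (.lit 0))
    (.loop (.sub (.reg y) (.reg x)) (.seq P (.assign x (.add (.reg x) (.lit 1)))))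

/-- Each round spends one operation on the guard and one on the increment besides the body; the
final `2` are the initial assignment and the failing guard. The body preserves the invariant up to
the increment, which is why it is required of `υ.setReg x (j + 1)`. -/
theorem Wp.forP {x y n : ℕ} (Inv : ℕ → Mem → Prop) (hn : σ.reg y = n) (hxy : y ≠ x)
    (hx : P.writesReg x = false) (hy : P.writesReg y = false) (h0 : Inv 0 (σ.setReg x 0))
    (hstep : ∀ j τ, j < n → Frame (BudgetedMatchoid.forP x y P) σ τ → τ.reg x = j →
      Inv j τ → Wp I ε V J P N τ (fun υ => Inv (j + 1) (υ.setReg x (j + 1))))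
    (hQ : ∀ τ, Frame (BudgetedMatchoid.forP x y P) σ τ → Inv n τ → Q τ) :
    Wp I ε V J (BudgetedMatchoid.forP x y P) (n * (N + 2) + 2) σ Q := by
  subst hn
  have hyF : (BudgetedMatchoid.forP x y P).writesReg y = false := by
    simp [BudgetedMatchoid.forP, Prog.writesReg, hy, hxy]
  -- Induction on the number `r` of remaining rounds.
  have key : ∀ r j τ, j + r = σ.reg y → Frame (BudgetedMatchoid.forP x y P) σ τ → τ.reg x = j →
      Inv j τ → Wp I ε V J
        (.loop (.sub (.reg y) (.reg x)) (.seq P (.assign x (.add (.reg x) (.lit 1)))))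
        (r * (N + 2) + 1) τ Q := by
    intro r
    induction r with
    | zero =>
      intro j τ hj hF hxj hI
      refine (Wp.loop_done (by simp [AExp.weight]) ?_ (hQ τ hF ?_)).le (by omega)
      · simp only [AExp.eval, hF.reg y hyF]
        omega
      · rwa [show σ.reg y = j by omega]
    | succ r ih =>
      intro j τ hj hF hxj hI
      have hlt : j < σ.reg y := by omega
      refine (Wp.loop_step (N := N + 1) (N' := r * (N + 2) + 1)
        (R := fun υ => υ.reg x = j + 1 ∧ Inv (j + 1) υ) (by simp [AExp.weight]) ?_
        (Wp.seq (hstep j τ hlt hF hxj hI) ?_) ?_).le (by ring_nf; omega)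
      · simp only [AExp.eval, hF.reg y hyF]
        omega
      · intro υ hυ hI'
        have hj : υ.reg x = j := by rw [hυ.reg x hx, hxj]
        refine Wp.of_bdd fun hb => Wp.assign (by simp [AExp.weight]) (fun _ => ?_) ?_
        -- The counter stays within `V` because it never exceeds the content of register `y`.
        · have h1 := hb.2.1 y
          rw [hυ.reg y hy, hF.reg y hyF] at h1
          simp only [AExp.eval, hj]
          omega
        · simp only [AExp.eval, hj]
          exact ⟨by simp, hI'⟩
      · intro υ hυ hI'
        refine ih (j + 1) υ (by omega) (hF.trans (hυ.of_subprog ?_ ?_)) hI'.1 hI'.2 <;>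
          intro z <;> simp only [BudgetedMatchoid.forP, Prog.writesReg, Prog.writesArr] <;>
          simp +contextual
  refine (Wp.seq_assign (by simp [AExp.weight]) (fun _ => Nat.zero_le _)
    (key (σ.reg y) 0 (σ.setReg x 0) (by omega) ?_ (by simp) h0)).le (by omega)
  refine ⟨fun z hz => ?_, fun _ _ => rfl⟩
  have : z ≠ x := by
    rintro rfl
    simp [BudgetedMatchoid.forP, Prog.writesReg] at hz
  simp [this]

/-- Set the cells of array `a` below the value of register `y` to the values of `e`, the running
index being in register `x`. -/
def fillP (x y a : ℕ) (e : AExp) : Prog := BudgetedMatchoid.forP x y (.store a (.reg x) e)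

theorem Wp.fillP {x y a n : ℕ} {e : AExp} (v : ℕ → ℕ) (hn : σ.reg y = n) (hxy : y ≠ x)
    (he : e.weight ≤ 40)
    (hv : ∀ τ, τ.Bdd V → τ.reg x < n → (∀ z, z ≠ x → τ.reg z = σ.reg z) →
      (∀ b, b ≠ a → τ.arr b = σ.arr b) → e.eval τ = v (τ.reg x) ∧ v (τ.reg x) ≤ V)
    (hQ : ∀ τ, (∀ z, z ≠ x → τ.reg z = σ.reg z) → (∀ b, b ≠ a → τ.arr b = σ.arr b) →
      (∀ j, τ.arr a j = if j < n then v j else σ.arr a j) → Q τ) :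
    Wp I ε V J (BudgetedMatchoid.fillP x y a e) (n * 3 + 2) σ Q := by
  subst hn
  have hF : ∀ τ, Frame (BudgetedMatchoid.forP x y (.store a (.reg x) e)) σ τ →
      (∀ z, z ≠ x → τ.reg z = σ.reg z) ∧ (∀ b, b ≠ a → τ.arr b = σ.arr b) := by
    refine fun τ h => ⟨fun z hz => h.reg z ?_, fun b hb => h.arr b ?_⟩ <;>
    simp [BudgetedMatchoid.forP, Prog.writesReg, Prog.writesArr, *]
  refine Wp.forP (fun r τ => ∀ j, τ.arr a j = if j < r then v j else σ.arr a j) rfl hxy rfl rfl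
    (by simp) ?_ ?_
  · intro j τ hj hf hx hI
    obtain ⟨h1, h2⟩ := hF τ hf
    refine Wp.of_bdd fun hb => ?_
    obtain ⟨h3, h4⟩ := hv τ hb (by omega) h1 h2
    refine Wp.store (by simp [AExp.weight]) he (fun _ => by rw [h3]; exact h4) ?_
    intro i
    simp only [Mem.setReg_arr, Mem.setArr_arr, if_true, Function.update_apply, AExp.eval, h3, hx, hI i]
    by_cases hij : i = j
    · simp [hij]
    · simp only [hij, if_false]
      congr 1
      simp; omega
  · intro τ hf hI
    exact hQ τ (hF τ hf).1 (hF τ hf).2 hI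

end Rules

/-! ### Representative elements -/

namespace BMInstance

variable (I : BMInstance)

theorem init_cost (e : Fin I.n) : I.init.arr 1 e = I.c e := by
  simp [BMInstance.init]

theorem init_profit (e : Fin I.n) : I.init.arr 2 e = I.p e := by
  simp [BMInstance.init]

theorem row_col_inj {n i j x y : ℕ} (hx : x < n) (hy : y < n) :
    i * n + x = j * n + y ↔ i = j ∧ x = y := by
  constructor
  · intro h
    have h1 : (i * n + x) / n = (j * n + y) / n := by rw [h]
    rw [mul_comm i, mul_comm j, Nat.mul_add_div (by omega), Nat.mul_add_div (by omega),
      Nat.div_eq_of_lt hx, Nat.div_eq_of_lt hy] at h1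
    have h2 : i = j := by simpa using h1
    subst h2
    exact ⟨rfl, by omega⟩
  · rintro ⟨rfl, rfl⟩
    rfl

open Classical in
theorem init_mem_iff (i : Fin I.s) (e : Fin I.n) :
    I.init.arr 3 (i * I.n + e) ≠ 0 ↔ e ∈ (I.M i).E := by
  have h : I.init.arr 3 (i * I.n + e) =
    if ∃ (i' : Fin I.s) (e' : Fin I.n), (i * I.n + e : ℕ) = i' * I.n + e' ∧ e' ∈ (I.M i').E
      then 1 else 0 := rfl
  rw [h]
  constructor
  · intro h
    split_ifs at h with h'
    · obtain ⟨i', e', h1, h2⟩ := h'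
      rw [row_col_inj e.2 e'.2] at h1
      rwa [Fin.ext h1.1, Fin.ext h1.2]
    · exact absurd rfl h
  · intro h
    rw [if_pos ⟨i, e, rfl, h⟩]
    exact one_ne_zero

/-- The elements marked in row `i` of a table with rows of length `n`. -/
def row (A : ℕ → ℕ) (i : ℕ) : Finset (Fin I.n) :=
  Finset.univ.filter fun f => A (i * I.n + f) ≠ 0

/-- The elements marked in row `i` together with `e`. -/
def rowInsert (A : ℕ → ℕ) (i e : ℕ) : Finset (Fin I.n) :=
  Finset.univ.filter fun f => A (i * I.n + f) ≠ 0 ∨ (f : ℕ) = e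

theorem rowInsert_eq (A : ℕ → ℕ) (i : ℕ) (e : Fin I.n) :
    I.rowInsert A i e = insert e (I.row A i) := by
  ext f
  simp [rowInsert, row, Fin.ext_iff, or_comm]

theorem row_update (A : ℕ → ℕ) (i j : ℕ) (x : Fin I.n) :
    I.row (Function.update A (i * I.n + x) 1) j =
      if j = i then insert x (I.row A j) else I.row A j := by
  ext f
  simp only [row, Finset.mem_filter, Finset.mem_univ, true_and, Function.update_apply,
    row_col_inj f.2 x.2]
  by_cases hj : j = i
  · by_cases hf : f = x <;> simp [hj, hf]
    simp [← Fin.ext_iff, hf]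
  · simp [hj]

/-- The profit class of an element, relative to the profit of `e₀` and the resolution `K`. -/
noncomputable def cls (K e₀ e : ℕ) : ℕ := I.init.arr 2 e * K / I.init.arr 2 e₀

/-- `e` has class `q`, is unmarked, and can be added to the rows of the first `r` matroids. -/
def Alive (K e₀ q : ℕ) (A : ℕ → ℕ) (e r : ℕ) : Prop :=
  (A (I.s * I.n + e) = 0 ∧ I.cls K e₀ e = q) ∧ ∀ i < r, I.init.arr 3 (i * I.n + e) ≠ 0 →
    A (i * I.n + e) = 0 ∧ I.oracle i (I.rowInsert A i e) ≠ 0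

open Classical in
/-- The cheapest alive element among the first `r` elements, or `n`. -/
noncomputable def pick (K e₀ q : ℕ) (A : ℕ → ℕ) : ℕ → ℕ
  | 0 => I.n
  | r + 1 =>
    if I.Alive K e₀ q A r I.s ∧ (I.n ≤ pick K e₀ q A r ∨
        I.init.arr 1 r < I.init.arr 1 (pick K e₀ q A r)) then r
    else pick K e₀ q A r

/-- Number of the first `a` matroids whose ground set contains `x`. -/
noncomputable def rank (x a : ℕ) : ℕ := Nat.count (fun i => I.init.arr 3 (i * I.n + x) ≠ 0) a

/-- The number of the `d`-th among the first `a` matroids whose ground set contains `x`, or `s`. -/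
noncomputable def slot (x d : ℕ) : ℕ → ℕ
  | 0 => I.s
  | a + 1 => if I.init.arr 3 (a * I.n + x) ≠ 0 ∧ I.rank x a = d then a else slot x d a

/-- Tables along a branch of the search tree that is given by the sequence `f`. -/
noncomputable def node (K e₀ q : ℕ) (f : ℕ → ℕ) : ℕ → ℕ → ℕ
  | 0 => fun _ => 0
  | j + 1 =>
    if I.pick K e₀ q (node K e₀ q f j) I.n < I.n then
      Function.update (node K e₀ q f j)
        (I.slot (I.pick K e₀ q (node K e₀ q f j) I.n) (f j) I.s * I.n +
          I.pick K e₀ q (node K e₀ q f j) I.n) 1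
    else node K e₀ q f j

theorem node_congr {K e₀ q : ℕ} {f g : ℕ → ℕ} {j : ℕ} (h : ∀ i < j, f i = g i) :
    I.node K e₀ q f j = I.node K e₀ q g j := by
  induction j with
  | zero => rfl
  | succ j ih =>
    simp only [node]
    rw [ih fun i hi => h i (by omega), h j (by omega)]

theorem pick_spec (K e₀ q : ℕ) (A : ℕ → ℕ) (r : ℕ) (hr : r ≤ I.n) :
    (I.pick K e₀ q A r = I.n ∧ ∀ e < r, ¬ I.Alive K e₀ q A e I.s) ∨
      (I.pick K e₀ q A r < I.n ∧ I.Alive K e₀ q A (I.pick K e₀ q A r) I.s ∧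
        ∀ e < r, I.Alive K e₀ q A e I.s →
          I.init.arr 1 (I.pick K e₀ q A r) ≤ I.init.arr 1 e) := by
  induction r with
  | zero => exact Or.inl ⟨rfl, fun e he => absurd he (by omega)⟩
  | succ r ih =>
    have h := ih (by omega)
    simp only [pick]
    split_ifs with hc
    · right
      refine ⟨by omega, hc.1, fun e he hA => ?_⟩
      rcases Nat.lt_succ_iff_lt_or_eq.1 he with he | rfl
      · rcases h with h | h
        · exact absurd hA (h.2 e he)
        · have := h.2.2 e he hA
          rcases hc.2 with h' | h' <;> omega
      · exact le_rfl
    · rcases h with h | h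
      · left
        refine ⟨h.1, fun e he hA => ?_⟩
        rcases Nat.lt_succ_iff_lt_or_eq.1 he with he | rfl
        · exact h.2 e he hA
        · exact hc ⟨hA, Or.inl (by omega)⟩
      · right
        refine ⟨h.1, h.2.1, fun e he hA => ?_⟩
        rcases Nat.lt_succ_iff_lt_or_eq.1 he with he | rfl
        · exact h.2.2 e he hA
        · by_contra hlt
          exact hc ⟨hA, Or.inr (by omega)⟩

theorem slot_le (x d a : ℕ) (ha : a ≤ I.s) : I.slot x d a ≤ I.s := by
  induction a with
  | zero => exact le_rfl
  | succ a ih =>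
    simp only [slot]
    split_ifs
    · omega
    · exact ih (by omega)

/-- Counting is injective on the matroids that contain `x`, so `slot` inverts `rank` there. -/
theorem slot_eq {x d i : ℕ} (hi : I.init.arr 3 (i * I.n + x) ≠ 0) (hd : I.rank x i = d) {a : ℕ}
    (ha : i < a) : I.slot x d a = i := by
  induction a with
  | zero => omega
  | succ a ih =>
    simp only [slot]
    split_ifs with h
    · exact Nat.count_injective h.1 hi (h.2.trans hd.symm)
    · rcases Nat.lt_succ_iff_lt_or_eq.1 ha with ha | rfl
      · exact ih ha
      · exact absurd ⟨hi, hd⟩ h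

/-- The default value `s` sends elements of no matroid to the extra row of the table. -/
theorem slot_eq_s {x d : ℕ} {a : ℕ} (h : ∀ i < a, I.init.arr 3 (i * I.n + x) = 0) :
    I.slot x d a = I.s := by
  induction a with
  | zero => rfl
  | succ a ih =>
    simp only [slot]
    rw [if_neg, ih fun i hi => h i (by omega)]
    exact fun h' => h'.1 (h a (by omega))

open Classical in
theorem card_matroids_le (x : Fin I.n) :
    (Finset.univ.filter fun i : Fin I.s => x ∈ (I.M i).E).card ≤ I.ℓ := by
  have h := I.matchoid x
  rwa [Set.ncard_eq_toFinset_card', Set.toFinset_ofPred] at h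

/-- The matchoid condition enters here: `ℓ` children per node reach every matroid that contains the
picked element. -/
theorem rank_lt {x : Fin I.n} {i : Fin I.s} (h : x ∈ (I.M i).E) : I.rank x i < I.ℓ := by
  classical
  have h1 : I.rank x i + 1 = I.rank x (i + 1) := by
    rw [rank, rank, Nat.count_succ, if_pos ((I.init_mem_iff i x).2 h)]
  have h2 : I.rank x (i + 1) ≤ I.rank x I.s := Nat.count_monotone _ i.2
  have h3 : I.rank x I.s = (Finset.univ.filter fun i : Fin I.s => x ∈ (I.M i).E).card := by
    rw [rank, Nat.count_eq_card_filter_range, ← Nat.Iio_eq_range, ← Fin.map_valEmbedding_univ, Finset.filter_map, Finset.card_map]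
    congr 1
    ext j
    simpa using I.init_mem_iff j x
  have := I.card_matroids_le x
  omega

theorem oracle_ne_zero_iff (i : Fin I.s) (S : Finset (Fin I.n)) :
    I.oracle i S ≠ 0 ↔ (I.M i).Indep (S : Set (Fin I.n)) := by
  unfold oracle
  constructor
  · intro h
    split_ifs at h with h'
    · exact h'.2
    · exact absurd rfl h
  · intro h
    rw [if_pos ⟨i.2, h⟩]
    exact one_ne_zero

/-- Invariant of the branch of the search tree that leads to a substitute for an element outside
`S`: the table holds independent sets spanned by `S`. -/
structure Spanned (S : Finset (Fin I.n)) (A : ℕ → ℕ) (j : ℕ) : Prop where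
  indep : ∀ i : Fin I.s, (I.M i).Indep (I.row A i : Set (Fin I.n))
  subset : ∀ i : Fin I.s, (I.row A i : Set (Fin I.n)) ⊆ (I.M i).closure (S ∩ (I.M i).E)
  free : ∀ x ∈ I.row A I.s, x ∈ S ∧ ∀ i, x ∉ (I.M i).E
  card : ∑ i ∈ Finset.range (I.s + 1), (I.row A i).card = j

-- This bounds the depth of the search. Row `i` is independent and lies in the closure of `S ∩ Eᵢ`,
-- so it has at most `|S ∩ Eᵢ|` elements, and row `s` consists of elements of `S` outside all
-- matroids. Counting by elements of `S`, each contributes the number of matroids containing it, or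
-- `1 ≤ ℓ` if there is none.
open Classical in
theorem Spanned.le {S : Finset (Fin I.n)} (hS : I.IsFeasible S) {A : ℕ → ℕ} {j : ℕ}
    (h : I.Spanned S A j) : j ≤ S.card * I.ℓ := by
  have h1 : ∀ i : Fin I.s, (I.row A i).card ≤ (S.filter fun x => x ∈ (I.M i).E).card := by
    intro i
    have h1 := (h.indep i).encard_le_eRk_of_subset (h.subset i)
    rw [Matroid.eRk_closure_eq, (hS i).eRk_eq_encard] at h1
    have h2 : (S : Set (Fin I.n)) ∩ (I.M i).E = ((S.filter fun x => x ∈ (I.M i).E : Finset _) : Set _) := by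
      ext; simp
    rw [h2, Set.encard_coe_eq_coe_finsetCard, Set.encard_coe_eq_coe_finsetCard] at h1
    exact_mod_cast h1
  have h2 : (I.row A I.s).card ≤ (S.filter fun x => ∀ i, x ∉ (I.M i).E).card :=
    Finset.card_le_card fun x hx => by simpa using h.free x hx
  have h3 : ∑ i : Fin I.s, (S.filter fun x => x ∈ (I.M i).E).card +
      (S.filter fun x => ∀ i, x ∉ (I.M i).E).card =
      ∑ x ∈ S, ((Finset.univ.filter fun i : Fin I.s => x ∈ (I.M i).E).card +
        if ∀ i, x ∉ (I.M i).E then 1 else 0) := by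
    rw [Finset.sum_add_distrib]
    congr 1
    · simp only [Finset.card_filter]
      exact Finset.sum_comm
    · simp only [Finset.card_filter]
  rw [← h.card, Finset.sum_range_succ, Finset.sum_range fun i => (I.row A i).card]
  refine (add_le_add (Finset.sum_le_sum fun i _ => h1 i) h2).trans (h3.le.trans ?_)
  rw [← smul_eq_mul]
  refine Finset.sum_le_card_nsmul _ _ _ fun x _ => ?_
  split_ifs with hx
  · have : (Finset.univ.filter fun i : Fin I.s => x ∈ (I.M i).E) = ∅ := by simpa using hx
    rw [this]
    simpa using Nat.one_le_iff_ne_zero.2 I.ℓ_pos.ne'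
  · simpa using I.card_matroids_le x

theorem Spanned.update {S : Finset (Fin I.n)} {A : ℕ → ℕ} {j : ℕ} (h : I.Spanned S A j)
    {i : ℕ} (hi : i ≤ I.s) {x : Fin I.n} (hx : x ∉ I.row A i)
    (hind : ∀ i' : Fin I.s, i = i' → (I.M i').Indep (insert x (I.row A i') : Finset (Fin I.n)) ∧
      x ∈ (I.M i').closure (S ∩ (I.M i').E))
    (hfree : i = I.s → x ∈ S ∧ ∀ i, x ∉ (I.M i).E) :
    I.Spanned S (Function.update A (i * I.n + x) 1) (j + 1) where
  indep i' := by
    rw [row_update]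
    split_ifs with h'
    · exact (hind i' h'.symm).1
    · exact h.indep i'
  subset i' := by
    rw [row_update]
    split_ifs with h'
    · rw [Finset.coe_insert, Set.insert_subset_iff]
      exact ⟨(hind i' h'.symm).2, h.subset i'⟩
    · exact h.subset i'
  free y hy := by
    rw [row_update] at hy
    split_ifs at hy with h'
    · rcases Finset.mem_insert.1 hy with rfl | hy
      · exact hfree h'.symm
      · exact h.free y hy
    · exact h.free y hy
  card := by
    rw [← h.card]
    have : ∀ i' ∈ Finset.range (I.s + 1), (I.row (Function.update A (i * I.n + x) 1) i').card =
        (I.row A i').card + if i' = i then 1 else 0 := by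
      intro i' _
      rw [row_update]
      split_ifs with h'
      · subst h'
        rw [Finset.card_insert_of_notMem hx]
      · rfl
    rw [Finset.sum_congr rfl this, Finset.sum_add_distrib, Finset.sum_ite_eq',
      if_pos (Finset.mem_range.2 (by omega))]

/-- By feasibility of `S`, in every matroid that contains it `e` lies outside the closure of the
rest of `S`. That closure contains the row, so `e` is not in the row and extends it independently.
Row `s` holds only elements of `S.erase e`. -/
theorem alive_of_spanned {S : Finset (Fin I.n)} (hS : I.IsFeasible S) {e : Fin I.n} (he : e ∈ S)
    {K e₀ : ℕ} {A : ℕ → ℕ} {j : ℕ} (h : I.Spanned (S.erase e) A j) :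
    I.Alive K e₀ (I.cls K e₀ e) A e I.s := by
  refine ⟨⟨?_, rfl⟩, fun i hi hm => ?_⟩
  · by_contra h'
    have := (h.free e (by simpa [row] using h')).1
    simp at this
  · have hE := (I.init_mem_iff ⟨i, hi⟩ e).1 hm
    have h1 : (I.M ⟨i, hi⟩).Indep
        (insert e (((S.erase e : Finset _) : Set (Fin I.n)) ∩ (I.M ⟨i, hi⟩).E)) := by
      convert hS ⟨i, hi⟩ using 1
      ext y
      by_cases hy : y = e <;> simp [hy, he, hE]
    have h2 : e ∉ (I.M ⟨i, hi⟩).closure (((S.erase e : Finset _) : Set (Fin I.n)) ∩ (I.M ⟨i, hi⟩).E) := by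
      have h3 := h1.subset (Set.subset_insert _ _)
      exact ((h3.insert_indep_iff_of_notMem (by simp)).1 h1).2
    have h3 : e ∉ (I.M ⟨i, hi⟩).closure (I.row A i) := fun h' =>
      h2 (((I.M ⟨i, hi⟩).closure_subset_closure_of_subset_closure (h.subset ⟨i, hi⟩)) h')
    have h4 : e ∉ I.row A i := fun h' => h2 (h.subset ⟨i, hi⟩ h')
    refine ⟨by simpa [row] using h4, ?_⟩
    rw [rowInsert_eq, I.oracle_ne_zero_iff ⟨i, hi⟩, Finset.coe_insert]
    exact ((h.indep ⟨i, hi⟩).insert_indep_iff_of_notMem (by exact_mod_cast h4)).2 ⟨hE, h3⟩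

/-- An alive `x` that cannot be added to `S` as a new element is spanned by `S` somewhere. If `x`
lies in no matroid, adding it cannot hurt feasibility, so `x ∈ S` and row `s` takes it. Otherwise
some `Eᵢ` contains `x` with `x` in the closure of `S ∩ Eᵢ`, either because `x ∈ S` or because
matroid `i` is the one violated. Aliveness keeps row `i` independent. -/
theorem exists_child {S : Finset (Fin I.n)} (hS : I.IsFeasible S) {x : Fin I.n}
    {K e₀ q : ℕ} {A : ℕ → ℕ} {j : ℕ} (h : I.Spanned S A j) (hx : I.Alive K e₀ q A x I.s)
    (hbad : ¬ (x ∉ S ∧ I.IsFeasible (insert x S))) :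
    ∃ d < I.ℓ, I.Spanned S (Function.update A (I.slot x d I.s * I.n + x) 1) (j + 1) := by
  by_cases hfree : ∀ i, x ∉ (I.M i).E
  · refine ⟨0, I.ℓ_pos, ?_⟩
    rw [I.slot_eq_s fun i hi => by
      have := (I.init_mem_iff ⟨i, hi⟩ x).not.2 (hfree _)
      simpa using this]
    refine Spanned.update I h le_rfl (by simpa [row] using hx.1.1) (fun i' hi' => ?_) fun _ => ⟨?_, hfree⟩
    · exact absurd i'.2 (by omega)
    · by_contra hxS
      refine hbad ⟨hxS, fun i => ?_⟩
      convert hS i using 1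
      ext y
      by_cases hy : y = x <;> simp [hy, hfree i]
  · have hex : ∃ i, x ∈ (I.M i).E ∧ x ∈ (I.M i).closure (S ∩ (I.M i).E) := by
      push Not at hfree
      obtain ⟨i, hi⟩ := hfree
      by_cases hxS : x ∈ S
      · exact ⟨i, hi, (I.M i).mem_closure_of_mem' ⟨hxS, hi⟩ hi⟩
      · have h1 : ¬ I.IsFeasible (insert x S) := fun h' => hbad ⟨hxS, h'⟩
        simp only [IsFeasible, not_forall] at h1
        obtain ⟨i', hi'⟩ := h1
        have hxE : x ∈ (I.M i').E := by
          by_contra hxE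
          apply hi'
          convert hS i' using 1
          ext y
          by_cases hy : y = x <;> simp [hy, hxE]
        refine ⟨i', hxE, ?_⟩
        by_contra hcl
        apply hi'
        have := ((hS i').insert_indep_iff_of_notMem (e := x) (by simp [hxS])).2 ⟨hxE, hcl⟩
        convert this using 1
        ext y
        by_cases hy : y = x <;> simp [hy, hxE]
    obtain ⟨i, hi, hcl⟩ := hex
    have hm := (I.init_mem_iff i x).2 hi
    refine ⟨I.rank x i, I.rank_lt hi, ?_⟩
    rw [I.slot_eq hm rfl i.2]
    have hA := hx.2 i i.2 hm
    refine Spanned.update I h i.2.le (by simpa [row] using hA.1) (fun i' hi' => ?_) fun hi' => ?_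
    · obtain rfl : i = i' := Fin.ext hi'
      refine ⟨?_, hcl⟩
      have := hA.2
      rwa [rowInsert_eq, I.oracle_ne_zero_iff] at this
    · exact absurd i.2 (by omega)

/-- Some branch of the search tree reaches a substitute for the element `e` of a feasible set. -/
theorem exists_substitute {S : Finset (Fin I.n)} (hS : I.IsFeasible S) (hk : S.card ≤ I.k)
    {e : Fin I.n} (he : e ∈ S) (K e₀ : ℕ) :
    ∃ f : ℕ → ℕ, (∀ i, f i < I.ℓ) ∧ ∃ j ≤ (I.k - 1) * I.ℓ, ∃ x : Fin I.n,
      I.pick K e₀ (I.cls K e₀ e) (I.node K e₀ (I.cls K e₀ e) f j) I.n = x ∧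
      I.cls K e₀ x = I.cls K e₀ e ∧ I.c x ≤ I.c e ∧ x ∉ S.erase e ∧
      I.IsFeasible (insert x (S.erase e)) := by
  set q := I.cls K e₀ e with hq
  have hS' : I.IsFeasible (S.erase e) := fun i =>
    (hS i).subset (Set.inter_subset_inter_left _ (by simp))
  -- Either a substitute has been picked above level `j`, or some branch has kept its rows spanned
  -- up to level `j`.
  have key : ∀ j, (∃ f : ℕ → ℕ, (∀ i, f i < I.ℓ) ∧ ∃ j' < j, ∃ x : Fin I.n,
      I.pick K e₀ q (I.node K e₀ q f j') I.n = x ∧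
      I.cls K e₀ x = q ∧ I.c x ≤ I.c e ∧ x ∉ S.erase e ∧ I.IsFeasible (insert x (S.erase e))) ∨
      ∃ f : ℕ → ℕ, (∀ i, f i < I.ℓ) ∧ I.Spanned (S.erase e) (I.node K e₀ q f j) j := by
    intro j
    induction j with
    | zero =>
      right
      refine ⟨fun _ => 0, fun _ => I.ℓ_pos, ⟨fun i => ?_, fun i => ?_, ?_, ?_⟩⟩ <;>
        simp [row, node]
    | succ j ih =>
      rcases ih with ⟨f, hf, j', hj', h⟩ | ⟨f, hf, h⟩
      · exact Or.inl ⟨f, hf, j', by omega, h⟩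
      · have hal := I.alive_of_spanned hS he (K := K) (e₀ := e₀) h
        rw [← hq] at hal
        rcases I.pick_spec K e₀ q (I.node K e₀ q f j) I.n le_rfl with h1 | ⟨h1, h2, h3⟩
        · exact absurd hal (h1.2 e e.2)
        · obtain ⟨x, hx⟩ : ∃ x : Fin I.n, I.pick K e₀ q (I.node K e₀ q f j) I.n = x :=
            ⟨⟨_, h1⟩, rfl⟩
          have h4 := h3 e e.2 hal
          rw [hx] at h2 h4
          rw [I.init_cost, I.init_cost] at h4
          by_cases hgood : x ∉ S.erase e ∧ I.IsFeasible (insert x (S.erase e))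
          · exact Or.inl ⟨f, hf, j, by omega, x, hx, h2.1.2, h4, hgood⟩
          · obtain ⟨d, hd, hsp⟩ := I.exists_child hS' h h2 hgood
            refine Or.inr ⟨Function.update f j d, fun i => ?_, ?_⟩
            · rw [Function.update_apply]
              split_ifs
              · exact hd
              · exact hf i
            -- Redirecting the branch at level `j` leaves the table at that level unchanged.
            · have hc : I.node K e₀ q (Function.update f j d) j = I.node K e₀ q f j :=
                I.node_congr fun i hi => by simp [hi.ne]
              simp only [node]
              rw [hc, hx, if_pos x.2, Function.update_self]
              exact hsp
  -- One level beyond the bound of `Spanned.le`, the second alternative is impossible.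
  rcases key ((I.k - 1) * I.ℓ + 1) with ⟨f, hf, j, hj, h⟩ | ⟨f, hf, h⟩
  · exact ⟨f, hf, j, by omega, h⟩
  · have h1 := Spanned.le I hS' h
    rw [Finset.card_erase_of_mem he] at h1
    have h2 : (S.card - 1) * I.ℓ ≤ (I.k - 1) * I.ℓ := Nat.mul_le_mul_right _ (by omega)
    omega

end BMInstance

/-- Every sequence of `D` digits in base `b` occurs in a number with given leading part `q`. -/
theorem exists_digits {b : ℕ} (hb : 0 < b) (q D : ℕ) (f : ℕ → ℕ) (hf : ∀ i, f i < b) :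
    ∃ u, u / b ^ D = q ∧ ∀ j < D, u / b ^ j % b = f j := by
  induction D generalizing f with
  | zero => exact ⟨q, by simp, by simp⟩
  | succ D ih =>
    obtain ⟨u, hu, hd⟩ := ih (fun i => f (i + 1)) fun i => hf _
    have h1 : (f 0 + b * u) / b = u := by
      rw [Nat.add_mul_div_left _ _ hb, Nat.div_eq_of_lt (hf 0), zero_add]
    refine ⟨f 0 + b * u, ?_, fun j hj => ?_⟩
    · rw [pow_succ', ← Nat.div_div_eq_div_mul, h1, hu]
    · cases j with
      | zero => simp [Nat.mod_eq_of_lt (hf 0)]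
      | succ j => rw [pow_succ', ← Nat.div_div_eq_div_mul, h1, hd j (by omega)]

/-! ### Exchanging a solution for representatives -/

namespace BMInstance

variable (I : BMInstance)

/-- The set `R` contains all elements that the search trees for the classes `0, …, K` find. -/
def Covers (K e₀ D : ℕ) (R : Set ℕ) : Prop :=
  ∀ u < (K + 1) * I.ℓ ^ D, ∀ j ≤ D,
    I.pick K e₀ (u / I.ℓ ^ D) (I.node K e₀ (u / I.ℓ ^ D) (fun i => u / I.ℓ ^ i % I.ℓ) j) I.n < I.n →
    I.pick K e₀ (u / I.ℓ ^ D) (I.node K e₀ (u / I.ℓ ^ D) (fun i => u / I.ℓ ^ i % I.ℓ) j) I.n ∈ R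

/-- A single number `u` encodes a class, in its leading part, and a branch, in its lower base-`ℓ`
digits; the numbers below `(K + 1) * ℓ ^ D` therefore cover all branches for all classes up to `K`.
-/
theorem exists_substitute_mem {K e₀ : ℕ} {R : Set ℕ} (hR : I.Covers K e₀ ((I.k - 1) * I.ℓ) R)
    {S : Finset (Fin I.n)} (hS : I.IsFeasible S) (hk : S.card ≤ I.k)
    {e : Fin I.n} (he : e ∈ S) (hK : I.cls K e₀ e ≤ K) :
    ∃ x : Fin I.n, (x : ℕ) ∈ R ∧ I.cls K e₀ x = I.cls K e₀ e ∧ I.c x ≤ I.c e ∧ x ∉ S.erase e ∧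
      I.IsFeasible (insert x (S.erase e)) := by
  obtain ⟨f, hf, j, hj, x, hx, h⟩ := I.exists_substitute hS hk he K e₀
  obtain ⟨u, hu, hd⟩ := exists_digits I.ℓ_pos (I.cls K e₀ e) ((I.k - 1) * I.ℓ) f hf
  refine ⟨x, ?_, h⟩
  have h1 : u < (K + 1) * I.ℓ ^ ((I.k - 1) * I.ℓ) := by
    rw [← Nat.div_lt_iff_lt_mul (pow_pos I.ℓ_pos _), hu]
    omega
  have h2 := hR u h1 j hj
  rw [hu, I.node_congr fun i hi => hd i (by omega), hx] at h2
  exact h2 x.2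

open Classical in
/-- Exchanging all elements of a set for representative ones. -/
theorem exists_representative {K e₀ : ℕ} {R : Set ℕ}
    (hR : I.Covers K e₀ ((I.k - 1) * I.ℓ) R) (N : ℕ) :
    ∀ S : Finset (Fin I.n), I.IsFeasible S → S.card ≤ I.k → (∀ e ∈ S, I.cls K e₀ e ≤ K) →
      (S.filter fun e : Fin I.n => (e : ℕ) ∉ R).card = N →
      ∃ S' : Finset (Fin I.n), I.IsFeasible S' ∧ S'.card = S.card ∧ (∀ e ∈ S', (e : ℕ) ∈ R) ∧
        ∑ e ∈ S', I.c e ≤ ∑ e ∈ S, I.c e ∧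
        ∑ e ∈ S', I.cls K e₀ e = ∑ e ∈ S, I.cls K e₀ e := by
  induction N with
  | zero =>
    intro S hS _ _ hN
    refine ⟨S, hS, rfl, fun e he => ?_, le_rfl, rfl⟩
    rw [Finset.card_eq_zero, Finset.filter_eq_empty_iff] at hN
    simpa using hN he
  | succ N ih =>
    intro S hS hk hc hN
    obtain ⟨e, he⟩ := Finset.card_pos.1 (by omega : 0 < (S.filter fun e : Fin I.n => (e : ℕ) ∉ R).card)
    rw [Finset.mem_filter] at he
    obtain ⟨x, hxR, hxc, hxe, hxS, hf⟩ := I.exists_substitute_mem hR hS hk he.1 (hc e he.1)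
    have hcard : (insert x (S.erase e)).card = S.card := by
      rw [Finset.card_insert_of_notMem hxS, Finset.card_erase_add_one he.1]
    -- The exchange trades an element outside `R` for one inside, so the number of elements outside
    -- drops by one.
    obtain ⟨S', h1, h2, h3, h4, h5⟩ := ih (insert x (S.erase e)) hf (by omega) (by
      intro y hy
      rcases Finset.mem_insert.1 hy with rfl | hy
      · rw [hxc]
        exact hc e he.1
      · exact hc y (Finset.mem_of_mem_erase hy)) (by
      rw [Finset.filter_insert, if_neg (by simpa using hxR), Finset.filter_erase,
        Finset.card_erase_of_mem (by simp [he]), hN]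
      rfl)
    refine ⟨S', h1, h2.trans hcard, h3, h4.trans ?_, h5.trans ?_⟩
    · rw [Finset.sum_insert hxS, ← Finset.add_sum_erase S _ he.1]
      omega
    · rw [Finset.sum_insert hxS, ← Finset.add_sum_erase S _ he.1, hxc]

/-- If the list of representatives covers all classes of width `p(e₀) / (k Q)`, then it contains a
solution that is almost as profitable as `S`. -/
theorem exists_good_representative {Q : ℕ} (hQ : 0 < Q) {e₀ : Fin I.n} {R : Set ℕ}
    (hR : I.Covers (I.k * Q) e₀ ((I.k - 1) * I.ℓ) R) {S : Finset (Fin I.n)} (hS : I.IsSolution S)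
    (hmax : ∀ e ∈ S, I.p e ≤ I.p e₀) :
    ∃ S' : Finset (Fin I.n), I.IsSolution S' ∧ S'.card = S.card ∧ (∀ e ∈ S', (e : ℕ) ∈ R) ∧
      Q * ∑ e ∈ S, I.p e ≤ Q * ∑ e ∈ S', I.p e + I.p e₀ := by
  have hp := I.p_pos e₀
  have hK : 0 < I.k * Q := Nat.mul_pos I.k_pos hQ
  have hcls : ∀ e : Fin I.n, I.cls (I.k * Q) e₀ e = I.p e * (I.k * Q) / I.p e₀ := by
    intro e
    rw [cls, init_profit, init_profit]
  obtain ⟨S', h1, h2, h3, h4, h5⟩ := I.exists_representative hR _ S hS.1 hS.2.1 (by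
    intro e he
    rw [hcls]
    refine Nat.div_le_of_le_mul ?_
    exact Nat.mul_le_mul_right _ (hmax e he)) rfl
  refine ⟨S', ⟨h1, h2.le.trans hS.2.1, h4.trans hS.2.2⟩, h2, h3, ?_⟩
  have h6 : (∑ e ∈ S', I.cls (I.k * Q) e₀ e) * I.p e₀ ≤ (∑ e ∈ S', I.p e) * (I.k * Q) := by
    rw [Finset.sum_mul, Finset.sum_mul]
    refine Finset.sum_le_sum fun e _ => ?_
    rw [hcls]
    exact Nat.div_mul_le_self _ _
  -- Rounding down loses less than `p e₀` per element on this scale, hence at most `k * p e₀`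
  -- altogether; dividing by `k` leaves the claimed error.
  have h7 : (∑ e ∈ S, I.p e) * (I.k * Q) ≤
      (∑ e ∈ S, I.cls (I.k * Q) e₀ e) * I.p e₀ + S.card * I.p e₀ := by
    rw [Finset.sum_mul, Finset.sum_mul, ← smul_eq_mul S.card, ← Finset.sum_const,
      ← Finset.sum_add_distrib]
    refine Finset.sum_le_sum fun e _ => ?_
    rw [hcls]
    have := Nat.div_add_mod (I.p e * (I.k * Q)) (I.p e₀)
    have := Nat.mod_lt (I.p e * (I.k * Q)) hp
    rw [mul_comm _ (I.p e₀)]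
    omega
  have h8 : S.card * I.p e₀ ≤ I.k * I.p e₀ := Nat.mul_le_mul_right _ hS.2.1
  rw [h5] at h6
  have h9 : I.k * (Q * ∑ e ∈ S, I.p e) ≤ I.k * (Q * ∑ e ∈ S', I.p e + I.p e₀) := by
    calc I.k * (Q * ∑ e ∈ S, I.p e) = (∑ e ∈ S, I.p e) * (I.k * Q) := by ring
      _ ≤ (∑ e ∈ S', I.p e) * (I.k * Q) + I.k * I.p e₀ := by omega
      _ = _ := by ring
  exact Nat.le_of_mul_le_mul_left h9 I.k_pos

/-- A nonempty set of at most `k` members of a list of length `m` is the set of entries at the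
base-`m` digits of a number below `m ^ k`. -/
theorem exists_tuple {n m k : ℕ} {L : ℕ → ℕ} {S : Finset (Fin n)}
    (hne : S.Nonempty) (hk : S.card ≤ k) (hL : ∀ e ∈ S, ∃ a < m, L a = e) :
    ∃ t < m ^ k, ∀ x : ℕ, (∃ j < k, L (t / m ^ j % m) = x) ↔ ∃ e ∈ S, (e : ℕ) = x := by
  obtain ⟨e₀, he₀⟩ := hne
  have hm : 0 < m := by
    obtain ⟨a, ha, -⟩ := hL e₀ he₀
    omega
  choose! g hg hgL using hL
  -- Sets with fewer than `k` elements are padded by repeating `e₀`.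
  let h : ℕ → Fin n := fun j => if hj : j < S.card then (S.equivFin.symm ⟨j, hj⟩ : Fin n) else e₀
  have hh : ∀ j, h j ∈ S := by
    intro j
    simp only [h]
    split_ifs
    · exact Subtype.prop _
    · exact he₀
  obtain ⟨t, ht, hd⟩ := exists_digits hm 0 k (fun j => g (h j)) fun j => hg _ (hh j)
  refine ⟨t, ?_, fun x => ?_⟩
  · rcases Nat.div_eq_zero_iff.1 ht with h' | h'
    · exact absurd h' (pow_pos hm k).ne'
    · exact h'
  · constructor
    · rintro ⟨j, hj, rfl⟩
      exact ⟨h j, hh j, by rw [hd j hj, hgL _ (hh j)]⟩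
    · rintro ⟨e, he, rfl⟩
      have hlt := (S.equivFin ⟨e, he⟩).2
      refine ⟨S.equivFin ⟨e, he⟩, by omega, ?_⟩
      rw [hd _ (by omega), hgL _ (hh _)]
      simp [h]

end BMInstance

/-! ### The program

Registers and arrays get names.  The input is in the registers `0, …, 4` and the arrays
`1, 2, 3`. -/

notation "rQ" => (5 : ℕ)
notation "rDig" => (6 : ℕ)
notation "rPos" => (7 : ℕ)
notation "rK" => (8 : ℕ)
notation "rD" => (9 : ℕ)
notation "rDepth" => (10 : ℕ)
notation "rY" => (11 : ℕ)
notation "rWords" => (12 : ℕ)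
notation "rCells" => (13 : ℕ)
notation "rTop" => (14 : ℕ)
notation "rWord" => (15 : ℕ)
notation "rLen" => (16 : ℕ)
notation "rTuples" => (17 : ℕ)
notation "rTuple" => (18 : ℕ)
notation "rBest" => (19 : ℕ)
notation "rCls" => (20 : ℕ)
notation "rRest" => (21 : ℕ)
notation "rStep" => (22 : ℕ)
notation "rPick" => (23 : ℕ)
notation "rChild" => (24 : ℕ)
notation "rSlot" => (25 : ℕ)
notation "rScan" => (26 : ℕ)
notation "rCount" => (27 : ℕ)
notation "rElt" => (28 : ℕ)
notation "rAlive" => (29 : ℕ)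
notation "rMat" => (30 : ℕ)
notation "rIdx" => (31 : ℕ)
notation "rAns" => (32 : ℕ)
notation "rTail" => (33 : ℕ)
notation "rEntry" => (34 : ℕ)
notation "rOk" => (35 : ℕ)
notation "rCost" => (36 : ℕ)
notation "rProfit" => (37 : ℕ)
notation "rPow" => (38 : ℕ)
notation "aTable" => (4 : ℕ)
notation "aQuery" => (5 : ℕ)
notation "aList" => (6 : ℕ)
notation "aTuple" => (7 : ℕ)

/-- The input is still in its place. -/
structure Inputs (I : BMInstance) (σ : Mem) : Prop where
  reg : ∀ x < 5, σ.reg x = I.init.reg x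
  arr : ∀ a < 4, 0 < a → σ.arr a = I.init.arr a

namespace Inputs

variable {I : BMInstance} {σ τ : Mem} {P : Prog}

theorem n (h : Inputs I σ) : σ.reg 0 = I.n := h.reg 0 (by omega)
theorem s (h : Inputs I σ) : σ.reg 1 = I.s := h.reg 1 (by omega)
theorem k (h : Inputs I σ) : σ.reg 2 = I.k := h.reg 2 (by omega)
theorem ℓ (h : Inputs I σ) : σ.reg 3 = I.ℓ := h.reg 3 (by omega)
theorem B (h : Inputs I σ) : σ.reg 4 = I.B := h.reg 4 (by omega)
theorem c (h : Inputs I σ) : σ.arr 1 = I.init.arr 1 := h.arr 1 (by omega) (by omega)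
theorem p (h : Inputs I σ) : σ.arr 2 = I.init.arr 2 := h.arr 2 (by omega) (by omega)
theorem E (h : Inputs I σ) : σ.arr 3 = I.init.arr 3 := h.arr 3 (by omega) (by omega)

theorem frame (h : Inputs I σ) (hf : Frame P σ τ) (hr : ∀ x < 5, P.writesReg x = false)
    (ha : ∀ a < 4, 0 < a → P.writesArr a = false) : Inputs I τ :=
  ⟨fun x hx => (hf.reg x (hr x hx)).trans (h.reg x hx),
    fun a hx h0 => (hf.arr a (ha a hx h0)).trans (h.arr a hx h0)⟩

theorem setReg (h : Inputs I σ) {x v : ℕ} (hx : 5 ≤ x) : Inputs I (σ.setReg x v) :=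
  ⟨fun y hy => by rw [Mem.setReg_reg, if_neg (by omega), h.reg y hy], h.arr⟩

theorem setArr (h : Inputs I σ) {a i v : ℕ} (ha : 4 ≤ a) : Inputs I (σ.setArr a i v) :=
  ⟨h.reg, fun b hb h0 => by rw [Mem.setArr_arr, if_neg (by omega), h.arr b hb h0]⟩

end Inputs

/-- The cell of a table with rows of length `n`. -/
def cellE (i x : ℕ) : AExp := .add (.mul (.reg i) (.reg 0)) (.reg x)

/-- The profit class of the element in register `rElt`. -/
def clsE : AExp := .div (.mul (.arr 2 (.reg rElt)) (.reg rK)) (.arr 2 (.reg rTop))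

/-- Is the element in register `rElt` alive? -/
def aliveP : Prog :=
  .seq (.assign rAlive (.lit 1))
  -- Register `1` holds `s`, so the first summand is the cell in the extra row. The two truncated
  -- differences both vanish exactly when the classes agree.
  (.seq (.ite (.add (.arr aTable (cellE 1 rElt))
      (.add (.sub clsE (.reg rCls)) (.sub (.reg rCls) clsE))) (.assign rAlive (.lit 0)) .skip)
  (forP rMat 1 (.ite (.arr 3 (cellE rMat rElt))
    (.seq (fillP rIdx 0 aQuery (.arr aTable (cellE rMat rIdx)))
    (.seq (.store aQuery (.reg rElt) (.lit 1))
    (.seq (.query rAns (.reg rMat) aQuery)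
    -- The query alone would accept an element that is already in the row, so its cell is tested as
    -- well.
    (.ite (.add (.arr aTable (cellE rMat rElt)) (.sub (.lit 1) (.reg rAns)))
      (.assign rAlive (.lit 0)) .skip))))
    .skip)))

/-- Put the cheapest alive element into register `rPick`. -/
def pickP : Prog :=
  .seq (.assign rPick (.reg 0))
  (forP rElt 0 (.seq aliveP
    -- The guard is nonzero exactly when the element is alive and either nothing has been picked yet
    -- (`rPick` is at least `n`) or the picked element is more expensive.
    (.ite (.mul (.reg rAlive) (.add (.sub (.lit 1) (.sub (.reg 0) (.reg rPick)))
      (.sub (.arr 1 (.reg rPick)) (.arr 1 (.reg rElt)))))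
      (.assign rPick (.reg rElt)) .skip)))

/-- Put the number of the matroid in which the picked element is to be added into `rSlot`. -/
def slotP : Prog :=
  .seq (.assign rSlot (.reg 1))
  (.seq (.assign rCount (.lit 0))
  (forP rScan 1 (.ite (.arr 3 (cellE rScan rPick))
    (.seq (.ite (.add (.sub (.reg rCount) (.reg rChild)) (.sub (.reg rChild) (.reg rCount)))
      .skip (.assign rSlot (.reg rScan)))
      (.assign rCount (.add (.reg rCount) (.lit 1))))
    .skip)))

theorem BMInstance.alive_succ (I : BMInstance) (K e₀ q : ℕ) (A : ℕ → ℕ) (e r : ℕ) :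
    I.Alive K e₀ q A e (r + 1) ↔ I.Alive K e₀ q A e r ∧ (I.init.arr 3 (r * I.n + e) ≠ 0 →
      A (r * I.n + e) = 0 ∧ I.oracle r (I.rowInsert A r e) ≠ 0) := by
  simp only [BMInstance.Alive, Nat.forall_lt_succ_right, and_assoc]

/-! ### Correctness of one step of the search tree -/

section Specs

variable {I : BMInstance} {ε : ℝ} {V J : ℕ} {σ : Mem}

theorem aliveP_spec (hI : Inputs I σ) :
    Wp I ε V J aliveP ((I.s + 1) * (3 * I.n + 15)) σ fun τ => (τ.reg rAlive ≠ 0 ↔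
      I.Alive (σ.reg rK) (σ.reg rTop) (σ.reg rCls) (σ.arr aTable) (σ.reg rElt) I.s) := by
  unfold aliveP
  refine Wp.le (Wp.seq_assign (by decide) (fun hb => by have := hb.1; simp [AExp.eval]; omega)
    (Wp.seq (R := fun τ => (τ.reg rAlive ≠ 0 ↔ (σ.arr aTable (I.s * I.n + σ.reg rElt) = 0 ∧
      I.cls (σ.reg rK) (σ.reg rTop) (σ.reg rElt) = σ.reg rCls)))
      (Wp.ite (by decide)
        (fun h => Wp.assign (by decide) (fun _ => Nat.zero_le _) ?_) (fun h => Wp.skip ?_))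
      fun σ₁ hF₁ hR₁ => Wp.forP (N := 3 * I.n + 9) (fun j τ => (τ.reg rAlive ≠ 0 ↔
        I.Alive (σ.reg rK) (σ.reg rTop) (σ.reg rCls) (σ.arr aTable) (σ.reg rElt) j))
        ((hF₁.reg 1 rfl).trans hI.s) (by decide) rfl rfl ?_ ?_ ?_)) ?_
  · simp [AExp.eval, cellE, clsE, hI.n, hI.s, hI.p, BMInstance.cls] at h ⊢
    omega
  · simp [AExp.eval, cellE, clsE, hI.n, hI.s, hI.p, BMInstance.cls] at h ⊢
    omega
  · simpa [BMInstance.Alive] using hR₁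
  · intro j τ hj hF hx hInv
    have hIτ : Inputs I τ := ((hI.setReg (by omega)).frame hF₁ (by decide) (by decide)).frame hF
      (by decide) (by decide)
    have hT : τ.arr aTable = σ.arr aTable := (hF.arr _ rfl).trans (hF₁.arr _ rfl)
    have hE : τ.reg rElt = σ.reg rElt := (hF.reg _ rfl).trans (hF₁.reg _ rfl)
    refine (Wp.ite (N := 3 * I.n + 7) (by decide) (fun h => ?_) (fun h => Wp.skip ?_)).le (by omega)
    · refine Wp.le (Wp.seq (R := fun υ => (∀ z, z ≠ rIdx → υ.reg z = τ.reg z) ∧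
          (∀ b, b ≠ aQuery → υ.arr b = τ.arr b) ∧
          ∀ i < I.n, υ.arr aQuery i = σ.arr aTable (j * I.n + i))
        (Wp.fillP (fun i => σ.arr aTable (j * I.n + i)) hIτ.n (by decide) (by decide) ?_ ?_) (N' := 5) ?_) (by omega)
      · intro υ hb hlt hr ha
        have : (AExp.arr aTable (cellE rMat rIdx)).eval υ =
            σ.arr aTable (j * I.n + υ.reg rIdx) := by
          simp [AExp.eval, cellE, hr, ha, hx, hIτ.n, hT]
        refine ⟨this, ?_⟩
        rw [← this]
        exact hb.2.2 _ _
      · intro υ hr ha hv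
        exact ⟨hr, ha, fun i hi => by rw [hv, if_pos hi]⟩
      · rintro υ - ⟨hr, ha, hv⟩
        refine Wp.seq_store (by decide) (by decide)
          (fun hb => by have := hb.1; simp [AExp.eval]; omega)
          (Wp.seq_query (by decide) (Wp.ite (by decide)
            (fun h' => Wp.assign (by decide) (fun _ => Nat.zero_le _) ?_) fun h' => Wp.skip ?_))
        all_goals
          have hset : ((υ.setArr aQuery (υ.reg rElt) 1).toSet aQuery I.n) =
              I.rowInsert (σ.arr aTable) j (σ.reg rElt) := by
            ext f
            simp [Mem.toSet, BMInstance.rowInsert, Function.update_apply, hr, hE, hv f f.2]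
            by_cases hf : (f : ℕ) = σ.reg rElt <;> simp [hf]
          simp [AExp.eval, cellE, hr, ha, hx, hE, hT, hIτ.n, hIτ.E] at h h' ⊢
          have hle := I.oracle_le_one j (I.rowInsert (σ.arr aTable) j (σ.reg rElt))
          rw [hr _ (by decide), hE] at hset
          rw [hset] at h'
          rw [BMInstance.alive_succ]
        · rintro ⟨-, h0⟩
          obtain ⟨h1, h2⟩ := h0 h
          have := h' h1
          omega
        · have h1 : ¬ τ.reg rAlive = 0 ↔ _ := hInv
          rw [h1]
          exact ⟨fun h2 => ⟨h2, fun _ => ⟨h'.1, by omega⟩⟩, fun h2 => h2.1⟩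
    · simp [AExp.eval, cellE, hIτ.n, hIτ.E, hx, hE] at h
      simp only [BMInstance.alive_succ, Mem.setReg_reg]
      have h1 : τ.reg rAlive ≠ 0 ↔ _ := hInv
      simpa [h] using h1
  · exact fun τ _ h => h
  · nlinarith

theorem pickP_spec (hI : Inputs I σ) :
    Wp I ε V J pickP (I.n * ((I.s + 1) * (3 * I.n + 15) + 5) + 3) σ fun τ => τ.reg rPick =
      I.pick (σ.reg rK) (σ.reg rTop) (σ.reg rCls) (σ.arr aTable) I.n := by
  unfold pickP
  refine Wp.le (Wp.seq_assign (by decide) (fun hb => hb.2.1 _)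
    (Wp.forP (N := (I.s + 1) * (3 * I.n + 15) + 3) (fun j τ => τ.reg rPick =
      I.pick (σ.reg rK) (σ.reg rTop) (σ.reg rCls) (σ.arr aTable) j)
      hI.n (by decide) rfl rfl ?_ ?_ fun τ _ h => h)) (by linarith)
  · simp [AExp.eval, hI.n, BMInstance.pick]
  · intro j τ hj hF hx hInv
    have hIτ : Inputs I τ := (hI.setReg (by omega)).frame hF (by decide) (by decide)
    have e1 : τ.reg rK = σ.reg rK := hF.reg _ rfl
    have e2 : τ.reg rTop = σ.reg rTop := hF.reg _ rfl
    have e3 : τ.reg rCls = σ.reg rCls := hF.reg _ rfl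
    have e4 : τ.arr aTable = σ.arr aTable := hF.arr _ rfl
    refine Wp.seq (aliveP_spec hIτ) fun υ hυ hal => ?_
    have hIυ := hIτ.frame hυ (by decide) (by decide)
    have e5 : υ.reg rPick = τ.reg rPick := hυ.reg _ rfl
    have e6 : υ.reg rElt = j := (hυ.reg _ rfl).trans hx
    rw [e1, e2, e3, e4, hx] at hal
    refine Wp.le (Wp.ite (by decide)
      (fun h => Wp.assign (by decide) (fun hb => hb.2.1 _) ?_) fun h => Wp.skip ?_) le_rfl
    all_goals
      simp [AExp.eval, hIυ.n, hIυ.c, e5, e6, hInv] at h ⊢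
      simp only [BMInstance.pick]
    · rw [if_pos ⟨hal.1 h.1, by have := h.2; omega⟩]
    · rw [if_neg]
      rintro ⟨h1, h2⟩
      rcases h with h | h
      · exact hal.2 h1 h
      · omega

theorem slotP_spec (hI : Inputs I σ) :
    Wp I ε V J slotP (I.s * 8 + 4) σ fun τ =>
      τ.reg rSlot = I.slot (σ.reg rPick) (σ.reg rChild) I.s := by
  unfold slotP
  refine Wp.le (Wp.seq_assign (by decide) (fun hb => hb.2.1 _)
    (Wp.seq_assign (by decide) (fun hb => Nat.zero_le _)
    (Wp.forP (N := 6) (fun j τ => τ.reg rSlot = I.slot (σ.reg rPick) (σ.reg rChild) j ∧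
      τ.reg rCount = I.rank (σ.reg rPick) j)
      hI.s (by decide) rfl rfl ?_ ?_ fun τ _ h => h.1))) (by omega)
  · simp [AExp.eval, hI.s, BMInstance.slot, BMInstance.rank]
  · rintro j τ hj hF hx ⟨hInv, hc⟩
    have hIτ : Inputs I τ := ((hI.setReg (by omega)).setReg (by omega)).frame hF
      (by decide) (by decide)
    have e1 : τ.reg rPick = σ.reg rPick := hF.reg _ rfl
    have e2 : τ.reg rChild = σ.reg rChild := hF.reg _ rfl
    have hr : I.rank (σ.reg rPick) j ≤ j := Nat.count_le _
    refine Wp.ite (N := 4) (N' := 1) (by decide) (fun h => ?_) (fun h => Wp.skip ?_)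
    · simp [AExp.eval, cellE, hIτ.n, hIτ.E, hx, e1] at h
      refine Wp.le (Wp.seq (R := fun υ => υ.reg rSlot = I.slot (σ.reg rPick) (σ.reg rChild) (j + 1) ∧
        υ.reg rCount = I.rank (σ.reg rPick) j)
        (Wp.ite (by decide) (fun h' => Wp.skip ?_)
          (fun h' => Wp.assign (by decide) (fun hb => hb.2.1 _) ?_)) (N' := 1) ?_) (by omega)
      · simp [AExp.eval, hc, e2] at h'
        refine ⟨?_, hc⟩
        rw [hInv, BMInstance.slot, if_neg]
        rintro ⟨-, h2⟩
        omega
      · simp [AExp.eval, hc, e2] at h'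
        simp only [AExp.eval, Mem.setReg_reg, if_true, hx]
        refine ⟨?_, hc⟩
        rw [BMInstance.slot, if_pos ⟨h, by omega⟩]
      · rintro υ hυ ⟨h1, h2⟩
        have e3 : υ.reg 1 = I.s := (hυ.reg _ rfl).trans hIτ.s
        refine Wp.assign (by decide) (fun hb => ?_) ?_
        · have := hb.2.1 1
          simp only [AExp.eval, h2]
          omega
        · simp [AExp.eval, h1, h2, BMInstance.rank, Nat.count_succ, h]
    · simp [AExp.eval, cellE, hIτ.n, hIτ.E, hx, e1] at h
      simp [BMInstance.slot, BMInstance.rank, Nat.count_succ, h, hInv]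
      exact hc

end Specs

/-- Follow one branch of the search tree, adding the picked elements to the list. -/
def pathP : Prog :=
  .seq (.assign rCls (.div (.reg rWord) (.reg rY)))
  (.seq (.assign rRest (.reg rWord))
  (.seq (fillP rIdx rCells aTable (.lit 0))
  (forP rStep rDepth (.seq pickP
    (.seq (.ite (.sub (.reg 0) (.reg rPick))
      (.seq (.store aList (.reg rLen) (.reg rPick))
      (.seq (.assign rLen (.add (.reg rLen) (.lit 1)))
      (.seq (.assign rChild (.sub (.reg rRest) (.mul (.div (.reg rRest) (.reg 3)) (.reg 3))))
      (.seq slotP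
      (.store aTable (cellE rSlot rPick) (.lit 1))))))
      .skip)
    (.assign rRest (.div (.reg rRest) (.reg 3))))))))

/-- Register `dst` := (value of `base`) to the power (value of `ex`). -/
def powP (dst base ex : ℕ) : Prog :=
  .seq (.assign dst (.lit 1)) (forP rPow ex (.assign dst (.mul (.reg dst) (.reg base))))

/-- Mark the members of the current tuple of list entries. -/
def decodeP : Prog :=
  .seq (fillP rIdx 0 aTuple (.lit 0))
  (.seq (.assign rTail (.reg rTuple))
  (forP rEntry 2 (.seq (.store aTuple (.arr aList
      (.sub (.reg rTail) (.mul (.div (.reg rTail) (.reg rLen)) (.reg rLen)))) (.lit 1))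
    (.assign rTail (.div (.reg rTail) (.reg rLen))))))

/-- Compute cost and profit of the current set. -/
def weighP : Prog :=
  .seq (.assign rCost (.lit 0))
  (.seq (.assign rProfit (.lit 0))
  (forP rIdx 0 (.ite (.arr aTuple (.reg rIdx))
    (.seq (.assign rCost (.add (.reg rCost) (.arr 1 (.reg rIdx))))
      (.assign rProfit (.add (.reg rProfit) (.arr 2 (.reg rIdx)))))
    .skip)))

/-- Is the current set feasible? -/
def feasibleP : Prog :=
  .seq (.assign rOk (.lit 1))
  -- The oracle accepts only subsets of the ground set of the matroid, so the set is intersected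
  -- with it before the query.
  (forP rMat 1 (.seq (fillP rIdx 0 aQuery (.mul (.arr aTuple (.reg rIdx)) (.arr 3 (cellE rMat rIdx))))
    (.seq (.query rAns (.reg rMat) aQuery) (.ite (.reg rAns) .skip (.assign rOk (.lit 0))))))

/-- Test the current tuple and keep it if it is the best solution so far. -/
def tupleP : Prog :=
  .seq decodeP (.seq weighP (.seq feasibleP
    -- The guard is nonzero exactly for a feasible set with cost at most `B`, hence the `+ 1`, and
    -- profit above the best so far.
    (.ite (.mul (.reg rOk) (.mul (.sub (.add (.reg 4) (.lit 1)) (.reg rCost))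
        (.sub (.reg rProfit) (.reg rBest))))
      (.seq (.assign rBest (.reg rProfit)) (fillP rIdx 0 0 (.arr aTuple (.reg rIdx))))
      .skip)))

/-- The numbers that are on the list. -/
def listed (σ : Mem) : Set ℕ := {v | ∃ a < σ.reg rLen, σ.arr aList a = v}

/-- Number of operations of `pickP`. -/
def pickSteps (n s : ℕ) : ℕ := n * ((s + 1) * (3 * n + 15) + 5) + 3

/-! ### Correctness of following a branch and of testing a tuple -/

section Specs

variable {I : BMInstance} {ε : ℝ} {V J : ℕ} {σ : Mem}

/-- The table is zero beyond its last cell. -/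
def TableZero (I : BMInstance) (σ : Mem) : Prop := ∀ i, (I.s + 1) * I.n ≤ i → σ.arr aTable i = 0

/-- The element picked at step `j` of the branch with number `u`. -/
noncomputable def BMInstance.picked (I : BMInstance) (K e₀ Y u j : ℕ) : ℕ :=
  I.pick K e₀ (u / Y) (I.node K e₀ (u / Y) (fun i => u / I.ℓ ^ i % I.ℓ) j) I.n

/-- Slots are at most `s`, so only the cells of the `s + 1` rows are ever marked. Clearing these
cells thus suffices to reset the table between branches. -/
theorem BMInstance.node_eq_zero (I : BMInstance) (K e₀ q : ℕ) (f : ℕ → ℕ) (j : ℕ) {i : ℕ}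
    (hi : (I.s + 1) * I.n ≤ i) : I.node K e₀ q f j i = 0 := by
  induction j with
  | zero => rfl
  | succ j ih =>
    simp only [BMInstance.node]
    split_ifs with h
    · rw [Function.update_of_ne _, ih]
      have h1 := Nat.mul_le_mul_right I.n
        (I.slot_le (I.pick K e₀ q (I.node K e₀ q f j) I.n) (f j) I.s le_rfl)
      rw [add_mul, one_mul] at hi
      omega
    · exact ih

/-- The invariant identifies the array with the function `node`, cell by cell. Initially this needs
`TableZero`, as the program clears only the first `(s + 1) * n` cells. The bound on the list length
keeps its counter within `V`. -/
theorem pathP_spec (hI : Inputs I σ) (hcells : σ.reg rCells = (I.s + 1) * I.n)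
    (hz : TableZero I σ) {d : ℕ} (hd : σ.reg rDepth = d) (hV : σ.reg rLen + d ≤ V) :
    Wp I ε V J pathP ((I.s + 1) * I.n * 3 + d * (pickSteps I.n I.s + 8 * I.s + 15) + 6) σ
      fun τ => TableZero I τ ∧ τ.reg rLen ≤ σ.reg rLen + d ∧ listed σ ⊆ listed τ ∧
        ∀ j < d, I.picked (σ.reg rK) (σ.reg rTop) (σ.reg rY) (σ.reg rWord) j < I.n →
          I.picked (σ.reg rK) (σ.reg rTop) (σ.reg rY) (σ.reg rWord) j ∈ listed τ := by
  set K := σ.reg rK with hK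
  set e₀ := σ.reg rTop with he₀
  set Y := σ.reg rY with hY
  set u := σ.reg rWord with hu
  unfold pathP
  refine Wp.le (Wp.seq_assign (by decide)
    (fun hb => (Nat.div_le_self _ _).trans (hb.2.1 rWord))
    (Wp.seq_assign (by decide) (fun hb => hb.2.1 _)
    (Wp.seq (R := fun τ => (∀ z, z ≠ rIdx → τ.reg z = ((σ.setReg rCls (u / Y)).setReg rRest u).reg z) ∧
          (∀ b, b ≠ aTable → τ.arr b = σ.arr b) ∧ τ.arr aTable = fun _ => 0)
      (Wp.fillP (fun _ => 0) hcells (by decide) (by decide) ?_ ?_) fun σ₁ hF₁ hR₁ =>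
    Wp.forP (N := pickSteps I.n I.s + 8 * I.s + 13) (fun j τ =>
      τ.arr aTable = I.node K e₀ (u / Y) (fun i => u / I.ℓ ^ i % I.ℓ) j ∧
      τ.reg rRest = u / I.ℓ ^ j ∧ τ.reg rLen ≤ σ.reg rLen + j ∧ listed σ ⊆ listed τ ∧
        ∀ j' < j, I.picked K e₀ Y u j' < I.n → I.picked K e₀ Y u j' ∈ listed τ)
      ((hF₁.reg rDepth rfl).trans hd) (by decide) rfl rfl ?_ ?_ ?_))) ?_
  · intro τ _ _ _ _
    exact ⟨rfl, Nat.zero_le _⟩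
  · intro τ h1 h2 h3
    refine ⟨h1, h2, funext fun i => ?_⟩
    rw [h3]
    split_ifs with h
    · rfl
    · exact hz i (by omega)
  · obtain ⟨h1, h2, h3⟩ := hR₁
    refine ⟨by simp [h3, BMInstance.node], by simp [h1], by simp [h1], ?_, by simp⟩
    intro v hv
    simpa [listed, h1, h2] using hv
  · rintro j τ hj hF hx ⟨hA, hR, hL, hsub, hpk⟩
    have hIσ₁ : Inputs I σ₁ := ((hI.setReg (by omega)).setReg (by omega)).frame hF₁
      (by decide) (by decide)
    have hIτ : Inputs I τ := hIσ₁.frame hF (by decide) (by decide)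
    have e1 : τ.reg rK = K := (hF.reg _ rfl).trans (hF₁.reg _ rfl)
    have e2 : τ.reg rTop = e₀ := (hF.reg _ rfl).trans (hF₁.reg _ rfl)
    have e3 : τ.reg rCls = u / Y := (hF.reg _ rfl).trans (hF₁.reg _ rfl)
    refine Wp.le (Wp.seq (pickP_spec hIτ) (N' := 8 * I.s + 13) fun υ hυ hp => ?_)
      (by unfold pickSteps; omega)
    rw [e1, e2, e3, hA] at hp
    have hp' : υ.reg rPick = I.picked K e₀ Y u j := hp
    have hIυ := hIτ.frame hυ (by decide) (by decide)
    have e4 : υ.reg rLen = τ.reg rLen := hυ.reg _ rfl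
    have e5 : υ.reg rRest = τ.reg rRest := hυ.reg _ rfl
    have e6 : υ.arr aTable = τ.arr aTable := hυ.arr _ rfl
    have e7 : υ.arr aList = τ.arr aList := hυ.arr _ rfl
    have hdiv : u / I.ℓ ^ j / I.ℓ = u / I.ℓ ^ (j + 1) := by
      rw [pow_succ, Nat.div_div_eq_div_mul]
    refine Wp.le (Wp.seq (R := fun φ =>
      φ.arr aTable = I.node K e₀ (u / Y) (fun i => u / I.ℓ ^ i % I.ℓ) (j + 1) ∧
      φ.reg rRest = u / I.ℓ ^ j ∧ φ.reg rLen ≤ σ.reg rLen + (j + 1) ∧ listed σ ⊆ listed φ ∧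
        ∀ j' < j + 1, I.picked K e₀ Y u j' < I.n → I.picked K e₀ Y u j' ∈ listed φ)
      (Wp.ite (by decide) (fun h => Wp.seq_store (by decide) (by decide) (fun hb => hb.2.1 _)
        (Wp.seq_assign (by decide) (fun hb => ?_) (Wp.seq_assign (by decide)
          (fun hb => (Nat.sub_le _ _).trans (hb.2.1 rRest))
          (Wp.seq (slotP_spec (((hIυ.setArr (by omega)).setReg (by omega)).setReg (by omega)))
            fun φ hφ hs =>
            Wp.store (by decide) (by decide) (fun hb => by have := hb.1; simp [AExp.eval]; omega)
            ?_)))) fun h => Wp.skip ?_)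
      fun φ hφ hR' => Wp.assign (by decide)
        (fun hb => (Nat.div_le_self _ _).trans (hb.2.1 rRest)) ?_) (by omega)
    · simp [AExp.eval, e4]
      omega
    · simp [AExp.eval, hIυ.n, hIυ.ℓ, hp', e5, hR] at h hs
      have hmod : u / I.ℓ ^ j - u / I.ℓ ^ j / I.ℓ * I.ℓ = u / I.ℓ ^ j % I.ℓ := by
        have := Nat.div_add_mod (u / I.ℓ ^ j) I.ℓ
        rw [mul_comm] at this
        omega
      rw [hmod] at hs
      have f1 : φ.reg rPick = I.picked K e₀ Y u j := (hφ.reg _ rfl).trans hp'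
      have f2 : φ.reg rRest = u / I.ℓ ^ j := (hφ.reg _ rfl).trans (e5.trans hR)
      have f3 : φ.reg rLen = τ.reg rLen + 1 := by
        rw [hφ.reg _ rfl]
        simp [AExp.eval, e4]
      have f4 : φ.arr aTable = υ.arr aTable := hφ.arr _ rfl
      have f5 : φ.arr aList = Function.update (τ.arr aList) (τ.reg rLen) (I.picked K e₀ Y u j) := by
        rw [hφ.arr _ rfl]
        simp [AExp.eval, e4, e7, hp']
      have f6 : φ.reg 0 = I.n := (hφ.reg _ rfl).trans hIυ.n
      have hlt : I.picked K e₀ Y u j < I.n := by omega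
      have hmono : ∀ v ∈ listed τ, ∃ a < τ.reg rLen + 1,
          Function.update (τ.arr aList) (τ.reg rLen) (I.picked K e₀ Y u j) a = v := by
        rintro v ⟨a, ha, rfl⟩
        exact ⟨a, by omega, Function.update_of_ne (by omega) _ _⟩
      refine ⟨?_, f2, ?_, ?_, ?_⟩
      · simp [AExp.eval, cellE, f1, f4, f6, hs, e6, hA, BMInstance.node]
        rw [if_pos (show I.pick K e₀ (u / Y) _ I.n < I.n from hlt)]
        rfl
      · rw [Mem.setArr_reg, f3]
        omega
      · intro v hv
        simpa [listed, f3, f5] using hmono v (hsub hv)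
      · intro j' hj' hlt'
        rcases Nat.lt_succ_iff_lt_or_eq.1 hj' with hj' | rfl
        · simpa [listed, f3, f5] using hmono _ (hpk j' hj' hlt')
        · refine ⟨τ.reg rLen, by simp [f3], by simp [f5]⟩
    -- Nothing is alive, `pick` returns `n`, and the table and the list stay as they are.
    · simp [AExp.eval, hIυ.n, hp'] at h
      have hl : listed υ = listed τ := by simp [listed, e4, e7]
      refine ⟨?_, e5.trans hR, by omega, hl ▸ hsub, ?_⟩
      · rw [e6, hA, BMInstance.node, if_neg]
        exact not_lt.2 (Nat.sub_eq_zero_iff_le.1 h)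
      · intro j' hj' hlt'
        rw [hl]
        rcases Nat.lt_succ_iff_lt_or_eq.1 hj' with hj' | rfl
        · exact hpk j' hj' hlt'
        · omega
    · obtain ⟨g1, g2, g3, g4, g5⟩ := hR'
      have g6 : φ.reg 3 = I.ℓ := (hφ.reg _ rfl).trans hIυ.ℓ
      refine ⟨by simpa using g1, ?_, by simpa using g3, ?_, ?_⟩
      · simp [AExp.eval, g2, g6, hdiv]
      · simpa [listed] using g4
      · simpa [listed] using g5
  · rintro τ hF ⟨hA, -, h1, h2, h3⟩
    exact ⟨fun i hi => by rw [hA]; exact I.node_eq_zero _ _ _ _ _ hi, h1, h2, h3⟩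
  · linarith

/-- All intermediate powers must be bounded, not only the last: the base may be `0`, the length of
an empty list, and then the powers are not increasing. -/
theorem powP_spec {dst base ex b r : ℕ} (hb : σ.reg base = b) (he : σ.reg ex = r)
    (hne : dst ≠ base) (hne' : dst ≠ ex) (h1 : dst ≠ rPow) (h2 : base ≠ rPow) (h3 : ex ≠ rPow)
    (hV : ∀ j ≤ r, b ^ j ≤ V) :
    Wp I ε V J (powP dst base ex) (r * 3 + 3) σ fun τ => τ.reg dst = b ^ r := by
  unfold powP
  refine Wp.le (Wp.seq_assign (by decide) (fun h => by have := h.1; simp [AExp.eval]; omega)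
    (Wp.forP (N := 1) (fun j τ => τ.reg dst = b ^ j) (n := r) ?_ h3 ?_ ?_ ?_ ?_
      fun τ _ h => h)) (by omega)
  · simpa [hne'.symm] using he
  · simpa [Prog.writesReg] using h1.symm
  · simpa [Prog.writesReg] using hne'.symm
  · simp [h1, AExp.eval]
  · intro j τ hj hF hx hInv
    have hbase : τ.reg base = b := by
      rw [hF.reg base (by simp [forP, Prog.writesReg, hne.symm, h2])]
      simpa [hne.symm] using hb
    have : (AExp.mul (.reg dst) (.reg base)).eval τ = b ^ (j + 1) := by
      simp [AExp.eval, hInv, hbase, pow_succ]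
    refine Wp.assign (by simp [AExp.weight]) (fun _ => ?_) ?_
    · rw [this]
      exact hV _ hj
    · rw [this]
      simp [h1]

/-- The set that tuple number `t` of a list `L` of length `m` describes. -/
def tupleSet (n k m t : ℕ) (L : ℕ → ℕ) : Finset (Fin n) :=
  Finset.univ.filter fun f => ∃ j < k, L (t / m ^ j % m) = f

/-- This is why the program need not test the cardinality constraint. -/
theorem card_tupleSet_le (n k m t : ℕ) (L : ℕ → ℕ) : (tupleSet n k m t L).card ≤ k := by
  have : (tupleSet n k m t L).map Fin.valEmbedding ⊆
      (Finset.range k).image fun j => L (t / m ^ j % m) := by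
    intro x hx
    simp only [tupleSet, Finset.mem_map, Finset.mem_filter] at hx
    obtain ⟨f, ⟨-, j, hj, h⟩, rfl⟩ := hx
    exact Finset.mem_image.2 ⟨j, Finset.mem_range.2 hj, h⟩
  calc _ = _ := (Finset.card_map _).symm
    _ ≤ _ := Finset.card_le_card this
    _ ≤ _ := Finset.card_image_le
    _ = k := Finset.card_range k

theorem decodeP_spec (hI : Inputs I σ) :
    Wp I ε V J decodeP (3 * I.n + 4 * I.k + 5) σ fun τ => τ.toSet aTuple I.n =
      tupleSet I.n I.k (σ.reg rLen) (σ.reg rTuple) (σ.arr aList) := by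
  set m := σ.reg rLen with hm
  set t := σ.reg rTuple with ht
  set L := σ.arr aList with hL
  unfold decodeP
  refine Wp.le (Wp.seq (R := fun τ => ∀ j < I.n, τ.arr aTuple j = 0)
    (Wp.fillP (fun _ => 0) hI.n (by decide) (by decide) ?_ ?_) fun σ₁ hF₁ hR₁ =>
    Wp.seq_assign (by decide) (fun hb => hb.2.1 _)
    (Wp.forP (N := 2) (fun j τ => τ.reg rTail = t / m ^ j ∧
      ∀ f < I.n, τ.arr aTuple f ≠ 0 ↔ ∃ j' < j, L (t / m ^ j' % m) = f) (n := I.k)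
      ((hF₁.reg 2 rfl).trans hI.k) (by decide) rfl rfl ?_ ?_ ?_)) (by omega)
  · intro τ _ _ _ _
    exact ⟨rfl, Nat.zero_le _⟩
  · intro τ _ _ h j hj
    rw [h, if_pos hj]
  · refine ⟨?_, fun f hf => by simp [hR₁ f hf]⟩
    simp [AExp.eval, hF₁.reg rTuple rfl, ← ht]
  · rintro j τ hj hF hx ⟨h1, h2⟩
    have e1 : τ.reg rLen = m := (hF.reg _ rfl).trans (hF₁.reg _ rfl)
    have e2 : τ.arr aList = L := (hF.arr _ rfl).trans (hF₁.arr _ rfl)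
    have hmod : t / m ^ j - t / m ^ j / m * m = t / m ^ j % m := by
      have := Nat.div_add_mod (t / m ^ j) m
      rw [mul_comm] at this
      omega
    refine Wp.seq_store (by decide) (by decide)
      (fun hb => by have := hb.1; simp [AExp.eval]; omega)
      (Wp.assign (by decide) (fun hb => (Nat.div_le_self _ _).trans (hb.2.1 rTail)) ⟨?_, ?_⟩)
    · simp [AExp.eval, h1, e1, pow_succ, Nat.div_div_eq_div_mul]
    · intro f hf
      rw [Nat.exists_lt_succ_right, ← h2 f hf]
      simp [AExp.eval, h1, e1, e2, hmod, Function.update_apply]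
      by_cases h : f = L (t / m ^ j % m) <;> simp [h, eq_comm]
  · rintro τ - ⟨-, h⟩
    ext f
    simpa [Mem.toSet, tupleSet] using h f f.2

theorem sum_range_ite_eq (σ : Mem) (a : ℕ) {n : ℕ} (w : ℕ → ℕ) (v : Fin n → ℕ)
    (hw : ∀ e : Fin n, w e = v e) :
    ∑ i ∈ Finset.range n, (if σ.arr a i ≠ 0 then w i else 0) = ∑ e ∈ σ.toSet a n, v e := by
  rw [Finset.sum_range fun i => if σ.arr a i ≠ 0 then w i else 0, Mem.toSet, Finset.sum_filter]
  simp only [hw]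

theorem weighP_spec (hI : Inputs I σ) (hc : ∑ e, I.c e ≤ V) (hp : ∑ e, I.p e ≤ V) :
    Wp I ε V J weighP (6 * I.n + 4) σ fun τ => τ.reg rCost = ∑ e ∈ σ.toSet aTuple I.n, I.c e ∧
      τ.reg rProfit = ∑ e ∈ σ.toSet aTuple I.n, I.p e := by
  unfold weighP
  -- Every partial sum, including the next summand, is below the total cost or profit of the ground
  -- set, which `V` bounds.
  have hbound : ∀ (w : ℕ → ℕ) (v : Fin I.n → ℕ), (∀ e : Fin I.n, w e = v e) → ∑ e, v e ≤ V →
      ∀ j < I.n, ∑ i ∈ Finset.range j, (if σ.arr aTuple i ≠ 0 then w i else 0) + w j ≤ V := by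
    intro w v hw hV j hj
    calc ∑ i ∈ Finset.range j, (if σ.arr aTuple i ≠ 0 then w i else 0) + w j
        ≤ ∑ i ∈ Finset.range j, w i + w j := by
          gcongr with i
          split_ifs <;> omega
      _ = ∑ i ∈ Finset.range (j + 1), w i := (Finset.sum_range_succ _ _).symm
      _ ≤ ∑ i ∈ Finset.range I.n, w i :=
          Finset.sum_le_sum_of_subset (Finset.range_subset_range.2 hj)
      _ = ∑ e, v e := by rw [Finset.sum_range]; simp only [hw]
      _ ≤ V := hV
  refine Wp.le (Wp.seq_assign (by decide) (fun _ => Nat.zero_le _)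
    (Wp.seq_assign (by decide) (fun _ => Nat.zero_le _)
    (Wp.forP (N := 4) (fun j τ =>
      τ.reg rCost = ∑ i ∈ Finset.range j, (if σ.arr aTuple i ≠ 0 then I.init.arr 1 i else 0) ∧
      τ.reg rProfit = ∑ i ∈ Finset.range j, (if σ.arr aTuple i ≠ 0 then I.init.arr 2 i else 0))
      (n := I.n) hI.n (by decide) rfl rfl ?_ ?_ ?_))) (by omega)
  · simp [AExp.eval]
  · rintro j τ hj hF hx ⟨h1, h2⟩
    have hIτ : Inputs I τ := ((hI.setReg (by omega)).setReg (by omega)).frame hF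
      (by decide) (by decide)
    have e1 : τ.arr aTuple = σ.arr aTuple := hF.arr _ rfl
    have b1 := hbound _ _ I.init_cost hc j hj
    have b2 := hbound _ _ I.init_profit hp j hj
    refine Wp.le (Wp.ite (by decide) (fun h => Wp.seq_assign (by decide) (fun _ => ?_)
      (Wp.assign (by decide) (fun _ => ?_) ?_)) fun h => Wp.skip ?_) (by omega)
    · simpa [AExp.eval, h1, hIτ.c, hx] using b1
    · simpa [AExp.eval, h2, hIτ.p, hx] using b2
    · simp [AExp.eval, hx, e1] at h
      simp [AExp.eval, h1, h2, hIτ.c, hIτ.p, hx, Finset.sum_range_succ, h]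
    · simp [AExp.eval, hx, e1] at h
      simp [h1, h2, Finset.sum_range_succ, h]
  · rintro τ - ⟨h1, h2⟩
    exact ⟨h1.trans (sum_range_ite_eq _ _ _ _ I.init_cost),
      h2.trans (sum_range_ite_eq _ _ _ _ I.init_profit)⟩

open Classical in
theorem feasibleP_spec (hI : Inputs I σ) :
    Wp I ε V J feasibleP (I.s * (3 * I.n + 8) + 3) σ fun τ =>
      (τ.reg rOk ≠ 0 ↔ I.IsFeasible (σ.toSet aTuple I.n)) := by
  unfold feasibleP
  refine Wp.le (Wp.seq_assign (by decide) (fun hb => by have := hb.1; simp [AExp.eval]; omega)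
    (Wp.forP (N := 3 * I.n + 6) (fun j τ => τ.reg rOk ≠ 0 ↔ ∀ i : Fin I.s, (i : ℕ) < j →
      (I.M i).Indep ((σ.toSet aTuple I.n : Set (Fin I.n)) ∩ (I.M i).E)) (n := I.s) hI.s (by decide)
      rfl rfl ?_ ?_ ?_)) (by linarith)
  · simp [AExp.eval]
  · intro j τ hj hF hx hInv
    have hIτ : Inputs I τ := (hI.setReg (by omega)).frame hF (by decide) (by decide)
    have e1 : τ.arr aTuple = σ.arr aTuple := hF.arr _ rfl
    refine Wp.le (Wp.seq (R := fun υ => υ.reg rOk = τ.reg rOk ∧ υ.reg rMat = j ∧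
        υ.toSet aQuery I.n =
          Finset.univ.filter fun f : Fin I.n => σ.arr aTuple f ≠ 0 ∧ f ∈ (I.M ⟨j, hj⟩).E)
      (Wp.fillP (fun i => σ.arr aTuple i * I.init.arr 3 (j * I.n + i)) hIτ.n (by decide)
        (by decide) ?_ ?_) (N' := 4) ?_) (by omega)
    · intro υ hb _ hr ha
      have hval : (AExp.mul (.arr aTuple (.reg rIdx)) (.arr 3 (cellE rMat rIdx))).eval υ =
          σ.arr aTuple (υ.reg rIdx) * I.init.arr 3 (j * I.n + υ.reg rIdx) := by
        simp [AExp.eval, cellE, hr, ha, hx, hIτ.n, hIτ.E, e1]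
      refine ⟨hval, ?_⟩
      have h1 := hb.2.2 aTuple (υ.reg rIdx)
      rw [ha _ (by decide), e1] at h1
      have h2 : I.init.arr 3 (j * I.n + υ.reg rIdx) ≤ 1 := by
        simp only [BMInstance.init]
        split_ifs <;> omega
      calc _ ≤ _ * 1 := Nat.mul_le_mul_left _ h2
        _ ≤ V := by omega
    · intro υ hr ha hv
      refine ⟨hr _ (by decide), (hr _ (by decide)).trans hx, ?_⟩
      ext f
      have := I.init_mem_iff ⟨j, hj⟩ f
      simp only [ne_eq] at this
      simp [Mem.toSet, hv, this]
    · rintro υ - ⟨h1, h2, h3⟩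
      have hset : ((υ.toSet aQuery I.n : Finset (Fin I.n)) : Set (Fin I.n)) =
          (σ.toSet aTuple I.n : Set (Fin I.n)) ∩ (I.M ⟨j, hj⟩).E := by
        rw [h3]
        ext f
        simp [Mem.toSet]
      have hor := I.oracle_ne_zero_iff ⟨j, hj⟩ (υ.toSet aQuery I.n)
      rw [hset] at hor
      have hsucc : (∀ i : Fin I.s, (i : ℕ) < j + 1 →
          (I.M i).Indep ((σ.toSet aTuple I.n : Set (Fin I.n)) ∩ (I.M i).E)) ↔
          (∀ i : Fin I.s, (i : ℕ) < j →
          (I.M i).Indep ((σ.toSet aTuple I.n : Set (Fin I.n)) ∩ (I.M i).E)) ∧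
          (I.M ⟨j, hj⟩).Indep ((σ.toSet aTuple I.n : Set (Fin I.n)) ∩ (I.M ⟨j, hj⟩).E) := by
        constructor
        · exact fun h => ⟨fun i hi => h i (by omega), h ⟨j, hj⟩ (by simp)⟩
        · rintro ⟨ha, hb⟩ i hi
          rcases Nat.lt_succ_iff_lt_or_eq.1 hi with hi | hi
          · exact ha i hi
          · obtain rfl : i = ⟨j, hj⟩ := Fin.ext hi
            exact hb
      refine Wp.seq_query (by decide) (Wp.ite (by decide) (fun h => Wp.skip ?_)
        fun h => Wp.assign (by decide) (fun _ => Nat.zero_le _) ?_)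
      · simp only [AExp.eval, Mem.setReg_reg, if_true, h2] at h
        rw [hsucc, ← hInv, ← hor]
        simp [h1, h]
      · simp only [AExp.eval, Mem.setReg_reg, if_true, h2] at h
        rw [hsucc, ← hor]
        simp [h, AExp.eval]
  · intro τ _ h
    rw [h]
    exact ⟨fun h i => h i i.2, fun h i _ => h i⟩

/-- Array `0` holds a solution of profit `rBest`. -/
def Holds (I : BMInstance) (σ : Mem) : Prop :=
  I.IsSolution (σ.toSet 0 I.n) ∧ ∑ e ∈ σ.toSet 0 I.n, I.p e = σ.reg rBest

theorem tupleP_spec (hI : Inputs I σ) (hc : ∑ e, I.c e ≤ V) (hp : ∑ e, I.p e ≤ V)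
    (hH : Holds I σ) :
    Wp I ε V J tupleP ((I.s + 5) * (3 * I.n + 8) + 4 * I.k) σ fun τ => Holds I τ ∧
      σ.reg rBest ≤ τ.reg rBest ∧
      (I.IsSolution (tupleSet I.n I.k (σ.reg rLen) (σ.reg rTuple) (σ.arr aList)) →
        ∑ e ∈ tupleSet I.n I.k (σ.reg rLen) (σ.reg rTuple) (σ.arr aList), I.p e ≤
          τ.reg rBest) := by
  set T := tupleSet I.n I.k (σ.reg rLen) (σ.reg rTuple) (σ.arr aList) with hT
  have hk : T.card ≤ I.k := card_tupleSet_le _ _ _ _ _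
  unfold tupleP
  refine Wp.le (Wp.seq (decodeP_spec hI) fun σ₁ hF₁ hR₁ => ?_) (N := (3 * I.n + 4 * I.k + 5) +
    (6 * I.n + 4 + (I.s * (3 * I.n + 8) + 3 + (1 + (1 + (I.n * 3 + 2) + 1))))) (by nlinarith)
  have hI₁ := hI.frame hF₁ (by decide) (by decide)
  refine Wp.seq (weighP_spec hI₁ hc hp) fun σ₂ hF₂ hR₂ => ?_
  have hI₂ := hI₁.frame hF₂ (by decide) (by decide)
  refine Wp.seq (feasibleP_spec hI₂) fun σ₃ hF₃ hR₃ => ?_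
  have hI₃ := hI₂.frame hF₃ (by decide) (by decide)
  have a1 : σ₃.arr aTuple = σ₁.arr aTuple := (hF₃.arr _ rfl).trans (hF₂.arr _ rfl)
  have a2 : σ₂.arr aTuple = σ₁.arr aTuple := hF₂.arr _ rfl
  have a3 : σ₃.arr 0 = σ.arr 0 := (hF₃.arr _ rfl).trans ((hF₂.arr _ rfl).trans (hF₁.arr _ rfl))
  have r1 : σ₃.reg rBest = σ.reg rBest :=
    (hF₃.reg _ rfl).trans ((hF₂.reg _ rfl).trans (hF₁.reg _ rfl))
  have r2 : σ₃.reg rCost = ∑ e ∈ T, I.c e := by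
    rw [hT, ← hR₁, ← hR₂.1]
    exact hF₃.reg _ rfl
  have r3 : σ₃.reg rProfit = ∑ e ∈ T, I.p e := by
    rw [hT, ← hR₁, ← hR₂.2]
    exact hF₃.reg _ rfl
  have hfeas : σ₃.reg rOk ≠ 0 ↔ I.IsFeasible T := by
    rw [hR₃, hT, ← hR₁]
    simp [Mem.toSet, a2]
  refine Wp.ite (by decide) (fun h => Wp.seq_assign (by decide) (fun hb => hb.2.1 _)
    (Wp.fillP (fun i => σ₁.arr aTuple i) hI₃.n (by decide) (by decide) ?_ ?_)) fun h => Wp.skip ?_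
  · intro τ hb _ hr ha
    have : (AExp.arr aTuple (.reg rIdx)).eval τ = σ₁.arr aTuple (τ.reg rIdx) := by
      simp [AExp.eval, ha, a1]
    refine ⟨this, ?_⟩
    rw [← this]
    exact hb.2.2 _ _
  · intro τ hr ha hv
    simp [AExp.eval, hI₃.B, r1, r2, r3] at h
    have hset : τ.toSet 0 I.n = T := by
      rw [hT, ← hR₁]
      ext f
      simp [Mem.toSet, hv]
    have hb : τ.reg rBest = ∑ e ∈ T, I.p e := by
      simp [hr, AExp.eval, r3]
    have hlt : σ.reg rBest < ∑ e ∈ T, I.p e := by omega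
    refine ⟨⟨?_, ?_⟩, ?_, ?_⟩
    · rw [hset]
      exact ⟨hfeas.1 h.1, hk, by omega⟩
    · rw [hset, hb]
    · omega
    · intro _
      omega
  · simp [AExp.eval, hI₃.B, r1, r2, r3] at h
    have hset : σ₃.toSet 0 I.n = σ.toSet 0 I.n := by
      simp [Mem.toSet, a3]
    refine ⟨⟨by rw [hset]; exact hH.1, by rw [hset, r1]; exact hH.2⟩, r1.ge, fun hsol => ?_⟩
    rw [r1]
    have h1 := hfeas.2 hsol.1
    have h2 := hsol.2.2
    rcases h with h | h | h
    · exact absurd h h1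
    · omega
    · omega

end Specs

/-- Treat the element in register `rTop` as the most profitable one of an optimal solution. -/
def topP : Prog :=
  .seq (.assign rLen (.lit 0))
  (.seq (forP rWord rWords pathP)
  (.seq (powP rTuples rLen 2)
  (forP rTuple rTuples tupleP)))

/-- Find the first nonzero digit of the error parameter. -/
def digitsP : Prog :=
  .seq (.assign rQ (.lit 1))
  (.seq (.assign rPos (.lit 0))
  (.seq (.assign rDig (.lit 0))
  (.loop (.sub (.lit 1) (.reg rDig))
    (.seq (.assign rPos (.add (.reg rPos) (.lit 1)))
    (.seq (.assign rQ (.mul (.reg rQ) (.lit 2)))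
    (.digit rDig (.reg rPos)))))))

/-- Compute the constants. -/
def setupP : Prog :=
  .seq digitsP
  (.seq (.assign rK (.mul (.reg 2) (.reg rQ)))
  (.seq (.assign rD (.mul (.sub (.reg 2) (.lit 1)) (.reg 3)))
  (.seq (.assign rDepth (.add (.reg rD) (.lit 1)))
  (.seq (powP rY 3 rD)
  (.seq (.assign rWords (.mul (.add (.reg rK) (.lit 1)) (.reg rY)))
  (.assign rCells (.mul (.add (.reg 1) (.lit 1)) (.reg 0))))))))

/-- The approximation scheme. -/
def schemeP : Prog := .seq setupP (forP rTop 0 topP)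

/-! ### Step counts and bounds for the numbers in memory -/

namespace BMInstance

variable (I : BMInstance)

/-- Depth of the search trees. -/
def depth : ℕ := (I.k - 1) * I.ℓ + 1

/-- Number of branches of the search trees of all classes. -/
def words (Q : ℕ) : ℕ := (I.k * Q + 1) * I.ℓ ^ ((I.k - 1) * I.ℓ)

/-- Bound for the length of the list. -/
def maxLen (Q : ℕ) : ℕ := I.words Q * I.depth

/-- Number of operations of `pathP`. -/
def pathSteps : ℕ :=
  (I.s + 1) * I.n * 3 + I.depth * (pickSteps I.n I.s + 8 * I.s + 15) + 6

/-- Number of operations of `tupleP`. -/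
def tupleSteps : ℕ := (I.s + 5) * (3 * I.n + 8) + 4 * I.k

/-- Number of operations of `topP`. -/
def topSteps (Q : ℕ) : ℕ :=
  I.words Q * (I.pathSteps + 2) + 3 * I.k + I.maxLen Q ^ I.k * (I.tupleSteps + 2) + 8

/-- The number `V` bounds all numbers that occur in the computation. -/
structure Enough (Q V : ℕ) : Prop where
  two : 2 ≤ V
  n : I.n ≤ V
  s : I.s ≤ V
  k : I.k ≤ V
  ℓ : I.ℓ ≤ V
  B : I.B ≤ V
  c : ∑ e, I.c e ≤ V
  p : ∑ e, I.p e ≤ V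
  cells : (I.s + 1) * I.n ≤ V
  pow : I.maxLen Q ^ I.k ≤ V

variable {I}

theorem words_pos (Q : ℕ) : 0 < I.words Q := Nat.mul_pos (by omega) (pow_pos I.ℓ_pos _)

theorem depth_pos : 0 < I.depth := Nat.succ_pos _

theorem maxLen_pos (Q : ℕ) : 0 < I.maxLen Q := Nat.mul_pos (words_pos Q) depth_pos

/-- The auxiliary quantities below are positive factors of `maxLen`, so the bound on its `k`-th
power covers them all. -/
theorem Enough.maxLen {Q V : ℕ} (h : I.Enough Q V) : I.maxLen Q ≤ V :=
  (Nat.le_self_pow I.k_pos.ne' _).trans h.pow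

theorem Enough.words {Q V : ℕ} (h : I.Enough Q V) : I.words Q ≤ V :=
  (Nat.le_mul_of_pos_right _ depth_pos).trans h.maxLen

theorem Enough.depth {Q V : ℕ} (h : I.Enough Q V) : I.depth ≤ V :=
  (Nat.le_mul_of_pos_left _ (words_pos Q)).trans h.maxLen

theorem Enough.branches {Q V : ℕ} (h : I.Enough Q V) : I.ℓ ^ ((I.k - 1) * I.ℓ) ≤ V :=
  (Nat.le_mul_of_pos_left _ (by omega)).trans h.words

theorem Enough.classes {Q V : ℕ} (h : I.Enough Q V) : I.k * Q + 1 ≤ V :=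
  (Nat.le_mul_of_pos_right _ (pow_pos I.ℓ_pos _)).trans h.words

theorem Enough.bdd_init {Q V : ℕ} (h : I.Enough Q V) : I.init.Bdd V := by
  have h2 := h.two
  refine ⟨h2, fun x => ?_, fun a i => ?_⟩
  · simp only [BMInstance.init]
    split
    exacts [h.n, h.s, h.k, h.ℓ, h.B, Nat.zero_le _]
  · simp only [BMInstance.init]
    split
    · split_ifs with hi
      · exact (Finset.single_le_sum (fun _ _ => Nat.zero_le _) (Finset.mem_univ _)).trans h.c
      · omega
    · split_ifs with hi
      · exact (Finset.single_le_sum (fun _ _ => Nat.zero_le _) (Finset.mem_univ _)).trans h.p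
      · omega
    · split_ifs <;> omega
    · omega

end BMInstance

/-- The constants have been computed. -/
structure Constants (I : BMInstance) (Q : ℕ) (σ : Mem) : Prop where
  K : σ.reg rK = I.k * Q
  depth : σ.reg rDepth = I.depth
  Y : σ.reg rY = I.ℓ ^ ((I.k - 1) * I.ℓ)
  words : σ.reg rWords = I.words Q
  cells : σ.reg rCells = (I.s + 1) * I.n

/-- Solutions with most profitable element `e₀` are not much more profitable than `b`. -/
def BMInstance.Nearly (I : BMInstance) (Q b : ℕ) (e₀ : Fin I.n) : Prop :=
  ∀ S : Finset (Fin I.n), I.IsSolution S → S.Nonempty → (∀ e ∈ S, I.p e ≤ I.p e₀) →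
    Q * ∑ e ∈ S, I.p e ≤ Q * b + I.p e₀

/-! ### Correctness of the scheme -/

section Specs

variable {I : BMInstance} {ε : ℝ} {V J Q : ℕ} {σ : Mem}

/-- After all words have been processed the list satisfies `Covers`. A solution `S` whose elements
are no more profitable than `e₀` then has a nearly as profitable replacement among the list entries;
that replacement is described by some tuple number below `m ^ k`, so the best profit found is at
least its profit. -/
theorem topP_spec (hI : Inputs I σ) (hC : Constants I Q σ) (hQ : 0 < Q) (hV : I.Enough Q V)
    (hH : Holds I σ) (hz : TableZero I σ) (e₀ : Fin I.n) (he₀ : σ.reg rTop = e₀) :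
    Wp I ε V J topP (I.topSteps Q) σ fun τ => Holds I τ ∧ TableZero I τ ∧
      σ.reg rBest ≤ τ.reg rBest ∧ I.Nearly Q (τ.reg rBest) e₀ := by
  unfold topP
  set D := (I.k - 1) * I.ℓ with hD
  refine Wp.le (Wp.seq_assign (by decide) (fun _ => Nat.zero_le _)
    (Wp.seq (R := fun τ => TableZero I τ ∧ τ.reg rLen ≤ I.maxLen Q ∧
      I.Covers (I.k * Q) e₀ D (listed τ))
    (Wp.forP (N := I.pathSteps) (n := I.words Q)
      (fun u τ => TableZero I τ ∧ τ.reg rLen ≤ u * I.depth ∧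
        ∀ u' < u, ∀ j < I.depth, I.picked (I.k * Q) e₀ (I.ℓ ^ D) u' j < I.n →
          I.picked (I.k * Q) e₀ (I.ℓ ^ D) u' j ∈ listed τ)
      hC.words (by decide) rfl rfl ⟨hz, by simp [AExp.eval], fun u' hu' => by omega⟩ ?_ ?_)
    (N' := 3 * I.k + I.maxLen Q ^ I.k * (I.tupleSteps + 2) + 5) ?_))
    (by unfold BMInstance.topSteps; omega)
  · rintro u τ hu hF hx ⟨h1, h2, h3⟩
    have hIτ : Inputs I τ := (hI.setReg (by omega)).frame hF (by decide) (by decide)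
    have c1 : τ.reg rK = I.k * Q := (hF.reg _ rfl).trans hC.K
    have c2 : τ.reg rY = I.ℓ ^ D := (hF.reg _ rfl).trans hC.Y
    have c3 : τ.reg rTop = e₀ := (hF.reg _ rfl).trans he₀
    have hle : (u + 1) * I.depth ≤ I.maxLen Q := Nat.mul_le_mul_right _ hu
    have hle' := hV.maxLen
    rw [add_mul, one_mul] at hle
    refine (pathP_spec hIτ ((hF.reg _ rfl).trans hC.cells) h1
      ((hF.reg rDepth rfl).trans hC.depth) (by omega)).mono le_rfl ?_
    rintro υ - - ⟨g1, g2, g3, g4⟩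
    rw [c1, c2, c3, hx] at g4
    refine ⟨g1, ?_, fun u' hu' j hj hlt => ?_⟩
    · rw [add_mul, one_mul]
      simp only [Mem.setReg_reg]
      exact g2.trans (by omega)
    · have : listed (υ.setReg rWord (u + 1)) = listed υ := by simp [listed]
      rw [this]
      rcases Nat.lt_succ_iff_lt_or_eq.1 hu' with hu' | rfl
      · exact g3 (h3 u' hu' j hj hlt)
      · exact g4 j hj hlt
  · rintro τ - ⟨h1, h2, h3⟩
    -- `depth` is `D + 1`, so its steps are the levels `0, …, D` of `Covers`.
    exact ⟨h1, h2, fun u hu j hj hlt => h3 u hu j (Nat.lt_succ_of_le hj) hlt⟩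
  · rintro σ₁ hF₁ ⟨hz₁, hm, hcov⟩
    have hI₁ : Inputs I σ₁ := (hI.setReg (by omega)).frame hF₁ (by decide) (by decide)
    set m := σ₁.reg rLen with hmdef
    have hpow : ∀ j ≤ I.k, m ^ j ≤ I.maxLen Q ^ I.k := fun j hj =>
      (Nat.pow_le_pow_left hm j).trans (Nat.pow_le_pow_right (BMInstance.maxLen_pos Q) hj)
    refine Wp.le (Wp.seq (powP_spec (b := m) (r := I.k) rfl hI₁.k (by decide) (by decide)
      (by decide) (by decide) (by decide) fun j hj => (hpow j hj).trans hV.pow)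
      (N' := I.maxLen Q ^ I.k * (I.tupleSteps + 2) + 2) fun σ₂ hF₂ hM => ?_) (by omega)
    have hI₂ : Inputs I σ₂ := hI₁.frame hF₂ (by decide) (by decide)
    have m₂ : σ₂.reg rLen = m := hF₂.reg _ rfl
    have a₂ : σ₂.arr aList = σ₁.arr aList := hF₂.arr _ rfl
    have b₂ : σ₂.reg rBest = σ.reg rBest := (hF₂.reg _ rfl).trans (hF₁.reg _ rfl)
    have H₂ : Holds I σ₂ := by
      have h0 : σ₂.arr 0 = σ.arr 0 := (hF₂.arr _ rfl).trans (hF₁.arr _ rfl)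
      have : σ₂.toSet 0 I.n = σ.toSet 0 I.n := by simp [Mem.toSet, h0]
      rw [Holds, this, b₂]
      exact hH
    refine Wp.le (Wp.forP (N := I.tupleSteps) (n := m ^ I.k) (fun t τ => Holds I τ ∧
      σ.reg rBest ≤ τ.reg rBest ∧ ∀ t' < t,
        I.IsSolution (tupleSet I.n I.k m t' (σ₁.arr aList)) →
        ∑ e ∈ tupleSet I.n I.k m t' (σ₁.arr aList), I.p e ≤ τ.reg rBest)
      hM (by decide) rfl rfl ⟨H₂, b₂.ge, fun t' ht' => by omega⟩ ?_ ?_) (by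
        have := Nat.mul_le_mul_right (I.tupleSteps + 2) (hpow I.k le_rfl)
        omega)
    · rintro t τ ht hF hx ⟨h1, h2, h3⟩
      have hIτ := hI₂.frame hF (by decide) (by decide)
      refine (tupleP_spec hIτ hV.c hV.p h1).mono le_rfl ?_
      rintro υ - - ⟨g1, g2, g3⟩
      have l1 : τ.reg rLen = m := (hF.reg _ rfl).trans m₂
      have l2 : τ.arr aList = σ₁.arr aList := (hF.arr _ rfl).trans a₂
      rw [l1, l2, hx] at g3
      refine ⟨g1, h2.trans g2, fun t' ht' hsol => ?_⟩
      rcases Nat.lt_succ_iff_lt_or_eq.1 ht' with ht' | rfl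
      · exact (h3 t' ht' hsol).trans g2
      · exact g3 hsol
    · rintro τ hF ⟨h1, h2, h3⟩
      refine ⟨h1, fun i hi => ?_, h2, fun S hS hne hmax => ?_⟩
      · rw [hF.arr _ rfl, hF₂.arr _ rfl]
        exact hz₁ i hi
      · obtain ⟨S', g1, g2, g3, g4⟩ := I.exists_good_representative hQ hcov hS hmax
        have hne' : S'.Nonempty := by
          rw [← Finset.card_pos, g2]
          exact hne.card_pos
        obtain ⟨t, ht, htS⟩ := BMInstance.exists_tuple (k := I.k) (m := m) (L := σ₁.arr aList)
          hne' g1.2.1 fun e he => g3 e he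
        have hset : tupleSet I.n I.k m t (σ₁.arr aList) = S' := by
          ext f
          rw [tupleSet, Finset.mem_filter, htS f]
          simp [Fin.val_inj]
        have h4 := h3 t ht
        rw [hset] at h4
        have h5 := Nat.mul_le_mul_left Q (h4 g1)
        omega

theorem digitsP_spec {j₀ : ℕ} (h0 : 0 < j₀) (h1 : 1 ≤ ε * 2 ^ j₀) (h2 : ∀ j < j₀, ε * 2 ^ j < 1)
    (hε : 0 < ε) (hV : 2 ^ j₀ ≤ V) (hJ : j₀ ≤ J) :
    Wp I ε V J digitsP (4 * j₀ + 4) σ fun τ => τ.reg rQ = 2 ^ j₀ := by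
  have hd : ∀ j < j₀, binaryDigit ε j = 0 := by
    intro j hj
    rw [binaryDigit, Nat.floor_eq_zero.2 (h2 j hj)]
  have hd₀ : binaryDigit ε j₀ = 1 := by
    -- One position earlier the scaled value is still below `1`, so at `j₀` it is below `2`.
    have : ⌊ε * 2 ^ j₀⌋₊ = 1 := by
      rw [Nat.floor_eq_iff (by positivity)]
      refine ⟨by simpa using h1, ?_⟩
      obtain ⟨j, rfl⟩ : ∃ j, j₀ = j + 1 := ⟨j₀ - 1, by omega⟩
      have := h2 j (by omega)
      rw [pow_succ]
      push_cast
      linarith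
    rw [binaryDigit, this]
  have key : ∀ r j τ, j + r = j₀ → τ.reg rPos = j → τ.reg rQ = 2 ^ j →
      τ.reg rDig = binaryDigit ε j → Wp I ε V J (.loop (.sub (.lit 1) (.reg rDig))
        (.seq (.assign rPos (.add (.reg rPos) (.lit 1)))
        (.seq (.assign rQ (.mul (.reg rQ) (.lit 2))) (.digit rDig (.reg rPos)))))
        (4 * r + 1) τ fun τ => τ.reg rQ = 2 ^ j₀ := by
    intro r
    induction r with
    | zero =>
      intro j τ hj hp hq hdig
      obtain rfl : j = j₀ := by omega
      exact Wp.loop_done (by decide) (by simp [AExp.eval, hdig, hd₀]) hq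
    | succ r ih =>
      intro j τ hj hp hq hdig
      have hpow : 2 ^ (j + 1) ≤ V := (Nat.pow_le_pow_right (by omega) (by omega)).trans hV
      have hlt : j + 1 < 2 ^ (j + 1) := Nat.lt_two_pow_self
      refine Wp.le (Wp.loop_step (R := fun υ => υ.reg rPos = j + 1 ∧ υ.reg rQ = 2 ^ (j + 1) ∧
        υ.reg rDig = binaryDigit ε (j + 1)) (by decide)
        (by simp [AExp.eval, hdig, hd j (by omega)])
        (Wp.seq_assign (by decide) (fun _ => ?_) (Wp.seq_assign (by decide) (fun _ => ?_)
          (Wp.digit (by decide) ?_ ?_))) fun υ _ h => ih (j + 1) υ (by omega) h.1 h.2.1 h.2.2)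
        (by omega)
      · simp only [AExp.eval, hp]
        omega
      · simpa [AExp.eval, hq, ← pow_succ] using hpow
      · simp [AExp.eval, hp]
        omega
      · simp [AExp.eval, hp, hq, pow_succ]
  have hV1 : 1 ≤ V := Nat.one_le_two_pow.trans hV
  unfold digitsP
  exact Wp.le (Wp.seq_assign (by decide) (fun _ => hV1) (Wp.seq_assign (by decide)
    (fun _ => Nat.zero_le _) (Wp.seq_assign (by decide) (fun _ => Nat.zero_le _)
      (key j₀ 0 _ (by omega) (by simp [AExp.eval]) (by simp [AExp.eval])
        (by simp [AExp.eval, hd 0 h0]))))) (by omega)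

theorem setupP_spec {j₀ : ℕ} (h0 : 0 < j₀) (h1 : 1 ≤ ε * 2 ^ j₀) (h2 : ∀ j < j₀, ε * 2 ^ j < 1)
    (hε : 0 < ε) (hV : I.Enough (2 ^ j₀) V) (hJ : j₀ ≤ J) (hI : Inputs I σ) :
    Wp I ε V J setupP (4 * j₀ + 3 * I.depth + 9) σ fun τ => Constants I (2 ^ j₀) τ := by
  have hcl := hV.classes
  have hkQ : 2 ^ j₀ ≤ I.k * 2 ^ j₀ := Nat.le_mul_of_pos_left _ I.k_pos
  unfold setupP
  refine Wp.le (Wp.seq (digitsP_spec h0 h1 h2 hε (by omega) hJ) fun σ₁ hF₁ hQ => ?_)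
    (N := 4 * j₀ + 4 + (1 + (1 + (1 + ((I.k - 1) * I.ℓ * 3 + 3 + (1 + 1))))))
    (by unfold BMInstance.depth; omega)
  have hI₁ := hI.frame hF₁ (by decide) (by decide)
  have hdepth := hV.depth
  unfold BMInstance.depth at hdepth
  refine Wp.seq_assign (by decide) (fun _ => ?_) (Wp.seq_assign (by decide) (fun _ => ?_)
    (Wp.seq_assign (by decide) (fun _ => ?_)
    (Wp.seq (powP_spec (b := I.ℓ) (r := (I.k - 1) * I.ℓ) ?_ ?_ (by decide) (by decide)
      (by decide) (by decide) (by decide) fun j hj => ?_) fun σ₂ hF₂ hY =>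
    Wp.seq_assign (by decide) (fun _ => ?_) (Wp.assign (by decide) (fun _ => ?_) ?_))))
  · simp [AExp.eval, hI₁.k, hQ]
    omega
  · simp [AExp.eval, hI₁.k, hI₁.ℓ]
    omega
  · simp [AExp.eval, hI₁.k, hI₁.ℓ]
    omega
  · simp [hI₁.ℓ]
  · simp [AExp.eval, hI₁.k, hI₁.ℓ]
  · exact (Nat.pow_le_pow_right I.ℓ_pos hj).trans hV.branches
  all_goals
    have c1 : σ₂.reg rK = I.k * 2 ^ j₀ := by
      rw [hF₂.reg _ rfl]
      simp [AExp.eval, hI₁.k, hQ]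
    have c2 : σ₂.reg rDepth = I.depth := by
      rw [hF₂.reg _ rfl]
      simp [AExp.eval, hI₁.k, hI₁.ℓ, BMInstance.depth]
    have c3 : σ₂.reg 0 = I.n := (hF₂.reg _ rfl).trans hI₁.n
    have c4 : σ₂.reg 1 = I.s := (hF₂.reg _ rfl).trans hI₁.s
  · simpa [AExp.eval, c1, hY, BMInstance.words] using hV.words
  · simpa [AExp.eval, c3, c4] using hV.cells
  · constructor <;> simp [AExp.eval, c1, c2, c3, c4, hY, BMInstance.words]

theorem schemeP_spec {j₀ : ℕ} (h0 : 0 < j₀) (h1 : 1 ≤ ε * 2 ^ j₀) (h2 : ∀ j < j₀, ε * 2 ^ j < 1)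
    (hε : 0 < ε) (hV : I.Enough (2 ^ j₀) V) (hJ : j₀ ≤ J) :
    Wp I ε V J schemeP
      (4 * j₀ + 3 * I.depth + I.n * (I.topSteps (2 ^ j₀) + 2) + 11) I.init
      fun τ => Holds I τ ∧ ∀ e₀, I.Nearly (2 ^ j₀) (τ.reg rBest) e₀ := by
  have hI : Inputs I I.init := ⟨fun _ _ => rfl, fun _ _ _ => rfl⟩
  unfold schemeP
  refine Wp.le (Wp.seq (setupP_spec h0 h1 h2 hε hV hJ hI) fun σ₁ hF₁ hC =>
    Wp.forP (N := I.topSteps (2 ^ j₀)) (n := I.n) (fun j τ => Holds I τ ∧ TableZero I τ ∧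
      ∀ e₀ : Fin I.n, (e₀ : ℕ) < j → I.Nearly (2 ^ j₀) (τ.reg rBest) e₀)
      ((hF₁.reg 0 rfl).trans hI.n) (by decide) rfl rfl ⟨?_, ?_, fun _ h => by omega⟩ ?_ ?_)
    (by omega)
  -- The zero memory already encodes a solution: the empty set, of profit `0`.
  · have ha : σ₁.arr 0 = fun _ => 0 := hF₁.arr 0 rfl
    have hb : σ₁.reg rBest = 0 := hF₁.reg _ rfl
    have hset : (σ₁.setReg rTop 0).toSet 0 I.n = ∅ := by
      simp [Mem.toSet, ha]
    rw [Holds, hset]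
    refine ⟨⟨fun i => ?_, by simp, by simp⟩, by simp [hb]⟩
    simp
  · intro i _
    have : σ₁.arr aTable = fun _ => 0 := hF₁.arr _ rfl
    simp [this]
  · rintro j τ hj hF hx ⟨g1, g2, g3⟩
    have hI₁ : Inputs I σ₁ := hI.frame hF₁ (by decide) (by decide)
    have hIτ : Inputs I τ := hI₁.frame hF (by decide) (by decide)
    have hCτ : Constants I (2 ^ j₀) τ :=
      ⟨(hF.reg _ rfl).trans hC.K, (hF.reg _ rfl).trans hC.depth, (hF.reg _ rfl).trans hC.Y,
        (hF.reg _ rfl).trans hC.words, (hF.reg _ rfl).trans hC.cells⟩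
    refine (topP_spec hIτ hCτ (by positivity) hV g1 g2 ⟨j, hj⟩ hx).mono le_rfl ?_
    rintro υ - - ⟨f1, f2, f3, f4⟩
    refine ⟨f1, f2, fun e₀ he₀ => ?_⟩
    rcases Nat.lt_succ_iff_lt_or_eq.1 he₀ with he₀ | he₀
    -- Being `Nearly` optimal survives an increase of the best profit.
    · intro S hS hne hmax
      have := g3 e₀ he₀ S hS hne hmax
      have := Nat.mul_le_mul_left (2 ^ j₀) f3
      simp only [Mem.setReg_reg]
      refine le_trans ‹_› ?_
      gcongr
      simpa using f3
    · obtain rfl : e₀ = ⟨j, hj⟩ := Fin.ext he₀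
      exact f4
  · rintro τ - ⟨g1, -, g3⟩
    exact ⟨g1, fun e₀ => g3 e₀ e₀.2⟩

end Specs

/-! ### Running time -/

theorem pickSteps_le {n s W : ℕ} (hn : n ≤ W) (hs : s + 1 ≤ W) : pickSteps n s ≤ 26 * W ^ 3 := by
  have h1 : 1 ≤ W := by omega
  have h2 : W ≤ W ^ 3 := Nat.le_self_pow (by omega) W
  have h3 : W ^ 2 ≤ W ^ 3 := Nat.pow_le_pow_right h1 (by omega)
  calc pickSteps n s ≤ W * (W * (3 * W + 15) + 5) + 3 := by unfold pickSteps; gcongr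
    _ = 3 * W ^ 3 + 15 * W ^ 2 + 5 * W + 3 := by ring
    _ ≤ 26 * W ^ 3 := by omega

namespace BMInstance

variable {I : BMInstance} {W Q : ℕ}

theorem pathSteps_le (hn : I.n ≤ W) (hs : I.s + 1 ≤ W) (hd : I.depth ≤ W) :
    I.pathSteps ≤ 58 * W ^ 4 := by
  have h1 : 1 ≤ W := by omega
  have h2 : W ≤ W ^ 4 := Nat.le_self_pow (by omega) W
  have h3 : W ^ 2 ≤ W ^ 4 := Nat.pow_le_pow_right h1 (by omega)
  calc I.pathSteps ≤ W * W * 3 + W * (26 * W ^ 3 + 8 * W + 15) + 6 := by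
        unfold pathSteps
        have := pickSteps_le hn hs
        gcongr
        omega
    _ = 26 * W ^ 4 + 11 * W ^ 2 + 15 * W + 6 := by ring
    _ ≤ 58 * W ^ 4 := by omega

theorem tupleSteps_le (hn : I.n ≤ W) (hs : I.s + 1 ≤ W) (hk : I.k ≤ W) :
    I.tupleSteps ≤ 59 * W ^ 2 := by
  have h1 : 1 ≤ W := by omega
  have h2 : W ≤ W ^ 2 := Nat.le_self_pow (by omega) W
  calc I.tupleSteps ≤ (W + 4) * (3 * W + 8) + 4 * W :=
        Nat.add_le_add (Nat.mul_le_mul (by omega) (by omega)) (by omega)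
    _ = 3 * W ^ 2 + 24 * W + 32 := by ring
    _ ≤ 59 * W ^ 2 := by omega

theorem topSteps_le (hn : I.n ≤ W) (hs : I.s + 1 ≤ W) (hk : I.k ≤ W) (hd : I.depth ≤ W) :
    I.topSteps Q ≤ 132 * (I.maxLen Q ^ I.k * W ^ 4) := by
  have h1 : 1 ≤ W := by omega
  have h2 : W ≤ W ^ 4 := Nat.le_self_pow (by omega) W
  have h3 : W ^ 2 ≤ W ^ 4 := Nat.pow_le_pow_right h1 (by omega)
  have hR : 1 ≤ I.maxLen Q ^ I.k := pow_pos (maxLen_pos Q) _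
  have hw : I.words Q ≤ I.maxLen Q ^ I.k :=
    (Nat.le_mul_of_pos_right _ depth_pos).trans (Nat.le_self_pow I.k_pos.ne' _)
  have h4 : W ^ 4 ≤ I.maxLen Q ^ I.k * W ^ 4 := Nat.le_mul_of_pos_left _ hR
  have hp := pathSteps_le hn hs hd
  have ht := tupleSteps_le hn hs hk
  calc I.topSteps Q ≤ I.maxLen Q ^ I.k * (60 * W ^ 4) + 3 * W +
        I.maxLen Q ^ I.k * (61 * W ^ 4) + 8 := by
        unfold topSteps
        gcongr <;> omega
    _ = 121 * (I.maxLen Q ^ I.k * W ^ 4) + (3 * W + 8) := by ring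
    _ ≤ 132 * (I.maxLen Q ^ I.k * W ^ 4) := by omega

theorem steps_le {j : ℕ} (hn : I.n ≤ W) (hs : I.s + 1 ≤ W) (hk : I.k ≤ W) (hd : I.depth ≤ W)
    (hj : j ≤ W) :
    4 * j + 3 * I.depth + I.n * (I.topSteps Q + 2) + 11 ≤
      152 * (I.maxLen Q ^ I.k * W ^ 5) := by
  have h1 : 1 ≤ W := by omega
  have h2 : W ≤ W ^ 5 := Nat.le_self_pow (by omega) W
  have hR : 1 ≤ I.maxLen Q ^ I.k := pow_pos (maxLen_pos Q) _
  have h4 : W ^ 5 ≤ I.maxLen Q ^ I.k * W ^ 5 := Nat.le_mul_of_pos_left _ hR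
  have ht := topSteps_le (Q := Q) hn hs hk hd
  calc _ ≤ 4 * W + 3 * W + W * (132 * (I.maxLen Q ^ I.k * W ^ 4) + 2) + 11 := by gcongr
    _ = 132 * (I.maxLen Q ^ I.k * W ^ 5) + (9 * W + 11) := by ring
    _ ≤ _ := by omega

theorem unitCost_le {V j : ℕ} (hn : I.n ≤ W) (hV : V.size ≤ W) (hj : j ≤ W) (h1 : 1 ≤ W) :
    unitCost I V j ≤ 4003 * W := by
  unfold unitCost
  omega

/-- A bound for all numbers that occur in the computation. -/
def numBound (I : BMInstance) (Q : ℕ) : ℕ :=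
  2 + I.n + I.s + I.k + I.ℓ + I.B + ∑ e, I.c e + ∑ e, I.p e + (I.s + 1) * I.n + I.maxLen Q ^ I.k

theorem enough_numBound (I : BMInstance) (Q : ℕ) : I.Enough Q (I.numBound Q) := by
  constructor <;> unfold numBound <;> omega

/-- Inductively, `x < 2 ^ a` and `y < 2 ^ b` give `x + y < (x + 1) * (y + 1) ≤ 2 ^ (a + b)`. -/
theorem sum_lt_two_pow {n : ℕ} (v : Fin n → ℕ) : ∑ e, v e < 2 ^ ∑ e, (v e).size := by
  induction n with
  | zero => simp
  | succ n ih =>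
    rw [Fin.sum_univ_succ, Fin.sum_univ_succ, pow_add]
    have h1 := Nat.lt_size_self (v 0)
    have h2 := ih fun e => v e.succ
    have h3 := Nat.mul_le_mul (Nat.succ_le_of_lt h1) (Nat.succ_le_of_lt h2)
    refine lt_of_lt_of_le ?_ h3
    rw [Nat.succ_mul_succ]
    omega

/-- Every input quantity is at most `2 ^ |I|`, so the summands other than `maxLen Q ^ k` add up to
at most `10 * 2 ^ |I|`; the summand `4` leaves room for a factor `2 ^ 4 = 16`. -/
theorem size_numBound_le (I : BMInstance) (Q : ℕ) :
    (I.numBound Q).size ≤ I.size + 4 + (I.maxLen Q ^ I.k).size := by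
  rw [Nat.size_le, pow_add, pow_add]
  have hR := Nat.lt_size_self (I.maxLen Q ^ I.k)
  have le : ∀ x a : ℕ, x < 2 ^ a → a ≤ I.size → x ≤ 2 ^ I.size := fun x a h h' =>
    h.le.trans (Nat.pow_le_pow_right (by omega) h')
  have hself : ∀ x : ℕ, x ≤ I.size → x ≤ 2 ^ I.size := fun x h => le x x Nat.lt_two_pow_self h
  have hn := hself I.n (by unfold BMInstance.size; omega)
  have hs := hself I.s (by unfold BMInstance.size; omega)
  have hsn := hself ((I.s + 1) * I.n) (by unfold BMInstance.size; rw [add_mul, one_mul]; omega)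
  have hk := le _ _ (Nat.lt_size_self I.k) (by unfold BMInstance.size; omega)
  have hl := le _ _ (Nat.lt_size_self I.ℓ) (by unfold BMInstance.size; omega)
  have hB := le _ _ (Nat.lt_size_self I.B) (by unfold BMInstance.size; omega)
  have hc := le _ _ (sum_lt_two_pow I.c) (by unfold BMInstance.size; omega)
  have hp := le _ _ (sum_lt_two_pow I.p) (by unfold BMInstance.size; omega)
  have h1 : 1 ≤ 2 ^ I.size := Nat.one_le_two_pow
  have h3 : 1 ≤ I.maxLen Q ^ I.k := pow_pos (maxLen_pos Q) _
  unfold numBound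
  have h2 : 2 + I.n + I.s + I.k + I.ℓ + I.B + ∑ e, I.c e + ∑ e, I.p e + (I.s + 1) * I.n ≤
      10 * 2 ^ I.size := by omega
  generalize 2 + I.n + I.s + I.k + I.ℓ + I.B + ∑ e, I.c e + ∑ e, I.p e + (I.s + 1) * I.n = a at *
  generalize I.maxLen Q ^ I.k = R at *
  generalize 2 ^ I.size = X at *
  generalize 2 ^ R.size = Y at *
  have hXY : Y ≤ X * Y := Nat.le_mul_of_pos_left _ h1
  have hXY' : X ≤ X * Y := Nat.le_mul_of_pos_right _ (by omega)
  calc a + R < 16 * (X * Y) := by omega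
    _ = X * 2 ^ 4 * Y := by ring

theorem one_le_size (I : BMInstance) : 1 ≤ I.size := by
  have := Nat.size_pos.2 I.B_pos
  unfold BMInstance.size
  omega

/-- The exponent `3 * k` of `k` has two sources: one factor `k` from the number of classes and one
from the depth give `k ^ (2 * k)`, and the constant `2 ^ k` is absorbed by `2 * k ^ k`. The exponent
`2 * k` of `ε⁻¹` absorbs the rounding of `Q` to a power of two, as `Q ≤ 2 * ε⁻¹ ≤ ε⁻¹ ^ 2`. -/
theorem maxLen_pow_le {ε : ℝ} (h0 : 0 < ε) (h1 : ε < 1 / 2) (hQ : 1 ≤ Q) (hQε : (Q : ℝ) ≤ 2 * ε⁻¹) :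
    ((I.maxLen Q ^ I.k : ℕ) : ℝ) ≤ 2 * paramBound 3 I.k I.ℓ ε := by
  have hε : 2 ≤ ε⁻¹ := by
    rw [le_inv_comm₀ (by norm_num) h0]
    linarith
  have hk := I.k_pos
  have hl := I.ℓ_pos
  have hnat : I.maxLen Q ≤ 2 * I.k ^ 2 * Q * I.ℓ ^ (I.k * I.ℓ) := by
    have e1 : I.k * Q + 1 ≤ 2 * (I.k * Q) := by
      have : 0 < I.k * Q := Nat.mul_pos hk hQ
      omega
    have e3 : (I.k - 1) * I.ℓ + I.ℓ = I.k * I.ℓ := by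
      rw [← Nat.succ_mul]
      congr 1
      omega
    have e2 : I.depth ≤ I.k * I.ℓ := by
      unfold depth
      omega
    calc I.maxLen Q ≤ 2 * (I.k * Q) * I.ℓ ^ ((I.k - 1) * I.ℓ) * (I.k * I.ℓ) := by
          unfold maxLen words
          gcongr
      -- The factor `ℓ` of the depth merges into the power of `ℓ`, since `(k - 1) * ℓ + 1 ≤ k * ℓ`.
      _ = 2 * I.k ^ 2 * Q * I.ℓ ^ ((I.k - 1) * I.ℓ + 1) := by ring
      _ ≤ _ := by gcongr; omega
  have hreal : (I.maxLen Q : ℝ) ≤ 2 * I.k ^ 2 * (ε⁻¹ ^ 2) * I.ℓ ^ (I.k * I.ℓ) := by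
    calc (I.maxLen Q : ℝ) ≤ 2 * I.k ^ 2 * Q * I.ℓ ^ (I.k * I.ℓ) := by exact_mod_cast hnat
      _ ≤ _ := by
        gcongr
        nlinarith
  have h2k : (2 : ℝ) ^ I.k ≤ 2 * (I.k : ℝ) ^ I.k := by
    have : 2 ^ I.k ≤ 2 * I.k ^ I.k := by
      rcases Nat.lt_or_ge I.k 2 with h | h
      · have : I.k = 1 := by omega
        simp [this]
      · have := Nat.pow_le_pow_left h I.k
        omega
    exact_mod_cast this
  push_cast
  calc (I.maxLen Q : ℝ) ^ I.k ≤ (2 * I.k ^ 2 * (ε⁻¹ ^ 2) * I.ℓ ^ (I.k * I.ℓ)) ^ I.k := by gcongr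
    _ = 2 ^ I.k * (I.k ^ (2 * I.k) * ε⁻¹ ^ (2 * I.k) * I.ℓ ^ (I.k ^ 2 * I.ℓ)) := by
      rw [mul_pow, mul_pow, mul_pow, ← pow_mul, ← pow_mul, ← pow_mul]
      ring_nf
    _ ≤ 2 * (I.k : ℝ) ^ I.k * (I.k ^ (2 * I.k) * ε⁻¹ ^ (2 * I.k) * I.ℓ ^ (I.k ^ 2 * I.ℓ)) := by
      gcongr
    _ = _ := by
      unfold paramBound
      rw [show 3 * I.k = I.k + 2 * I.k by ring, pow_add]
      ring

end BMInstance

/-- `1.5 * log 2 > 1`. -/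
theorem le_log_of_two_pow_le {a : ℕ} {G : ℝ} (h : (2 : ℝ) ^ a ≤ G) : (a : ℝ) ≤ 1.5 * Real.log G := by
  have h1 := Real.log_le_log (by positivity) h
  rw [Real.log_pow] at h1
  have h2 := Real.log_two_gt_d9
  have h3 : (0 : ℝ) ≤ a := Nat.cast_nonneg a
  nlinarith

section ParamBound

variable {k ℓ : ℕ} {ε : ℝ}

theorem inv_pow_le_paramBound (hk : 0 < k) (hl : 0 < ℓ) (h0 : 0 < ε) :
    ε⁻¹ ^ (2 * k) ≤ paramBound 3 k ℓ ε := by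
  unfold paramBound
  have h1 : (1 : ℝ) ≤ (ℓ : ℝ) ^ (k ^ 2 * ℓ) := one_le_pow₀ (by exact_mod_cast hl)
  have h2 : (1 : ℝ) ≤ (k : ℝ) ^ (3 * k) := one_le_pow₀ (by exact_mod_cast hk)
  have h3 : (0 : ℝ) < ε⁻¹ ^ (2 * k) := by positivity
  calc ε⁻¹ ^ (2 * k) = 1 * 1 * ε⁻¹ ^ (2 * k) := by ring
    _ ≤ _ := by gcongr

/-- Together with `two_pow_dim_le` this bounds `k` and `ℓ` by multiples of `log g`. Both are needed
because `k` and `ℓ` can be exponential in the encoding size. -/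
theorem two_pow_param_le (hk : 0 < k) (hl : 0 < ℓ) (h0 : 0 < ε) (h1 : ε < 1 / 2) :
    (2 : ℝ) ^ (2 * k) ≤ paramBound 3 k ℓ ε := by
  have hε : 2 ≤ ε⁻¹ := by
    rw [le_inv_comm₀ (by norm_num) h0]
    linarith
  exact le_trans (by gcongr) (inv_pow_le_paramBound hk hl h0)

theorem two_pow_dim_le (hk : 0 < k) (hl : 0 < ℓ) (h0 : 0 < ε) (h1 : ε < 1 / 2) :
    (2 : ℝ) ^ ℓ ≤ paramBound 3 k ℓ ε := by
  -- For `ℓ = 1` the power of `ℓ` is trivial, and the power of `ε⁻¹` has to pay.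
  rcases Nat.lt_or_ge ℓ 2 with h | h
  · refine le_trans ?_ (two_pow_param_le hk hl h0 h1)
    exact pow_le_pow_right₀ (by norm_num) (by omega)
  · have hε : 1 ≤ ε⁻¹ := by
      rw [le_inv_comm₀ (by norm_num) h0]
      linarith
    have h2 : (1 : ℝ) ≤ (k : ℝ) ^ (3 * k) := one_le_pow₀ (by exact_mod_cast hk)
    have h3 : (1 : ℝ) ≤ ε⁻¹ ^ (2 * k) := one_le_pow₀ hε
    have h4 : ℓ ≤ k ^ 2 * ℓ := Nat.le_mul_of_pos_left _ (by positivity)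
    have h5 : (2 : ℝ) ≤ ℓ := by exact_mod_cast h
    unfold paramBound
    calc (2 : ℝ) ^ ℓ = 2 ^ ℓ * 1 * 1 := by ring
      _ ≤ (ℓ : ℝ) ^ (k ^ 2 * ℓ) * (k : ℝ) ^ (3 * k) * ε⁻¹ ^ (2 * k) := by
        gcongr
        exact (pow_le_pow_left₀ (by norm_num) h5 _).trans
          (pow_le_pow_right₀ (by linarith) h4)

end ParamBound

/-- The position of the first nonzero binary digit of a number in `(0, 1/2)`. -/
theorem exists_first_digit {ε : ℝ} (h0 : 0 < ε) (h1 : ε < 1 / 2) :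
    ∃ j, 0 < j ∧ 1 ≤ ε * 2 ^ j ∧ ∀ i < j, ε * 2 ^ i < 1 := by
  classical
  have hex : ∃ j : ℕ, 1 ≤ ε * 2 ^ j := by
    obtain ⟨j, hj⟩ := pow_unbounded_of_one_lt ε⁻¹ (by norm_num : (1 : ℝ) < 2)
    refine ⟨j, ?_⟩
    have := mul_le_mul_of_nonneg_left hj.le h0.le
    rwa [mul_inv_cancel₀ h0.ne'] at this
  refine ⟨Nat.find hex, ?_, Nat.find_spec hex, fun i hi => not_le.1 (Nat.find_min hex hi)⟩
  rw [Nat.find_pos]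
  simp
  linarith

/-- One number `W`, of order `|I| * (log g) ^ 2`, dominates every polynomial factor. The step count
contributes `W ^ 5` and the cost of a single operation one more `W`, whence the exponents `6` and
`12`. -/
theorem time_le (I : BMInstance) {ε : ℝ} (h0 : 0 < ε) (h1 : ε < 1 / 2) {j : ℕ} (hj : 0 < j)
    (hmin : ∀ i < j, ε * 2 ^ i < 1) :
    (((4 * j + 3 * I.depth + I.n * (I.topSteps (2 ^ j) + 2) + 11) *
      unitCost I (I.numBound (2 ^ j)) j : ℕ) : ℝ) ≤ timeBound (152 * 4003 * 2 * 10 ^ 6) 6 3 12 I ε := by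
  set G := paramBound 3 I.k I.ℓ ε with hG
  set y := Real.log G with hy
  set z : ℝ := ((I.size : ℕ) : ℝ) with hz
  have hz1 : 1 ≤ z := by
    rw [hz]
    exact_mod_cast I.one_le_size
  have hε : 2 ≤ ε⁻¹ := by
    rw [le_inv_comm₀ (by norm_num) h0]
    linarith
  have hk := I.k_pos
  have hl := I.ℓ_pos
  have g1 := two_pow_param_le hk hl h0 h1
  have g2 := two_pow_dim_le hk hl h0 h1
  rw [← hG] at g1 g2
  have g4 : (4 : ℝ) ≤ G := by
    refine le_trans ?_ g1
    calc (4 : ℝ) = 2 ^ 2 := by norm_num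
      _ ≤ _ := pow_le_pow_right₀ (by norm_num) (by omega)
  have hQε : (2 : ℝ) ^ j ≤ 2 * ε⁻¹ := by
    obtain ⟨i, rfl⟩ : ∃ i, j = i + 1 := ⟨j - 1, by omega⟩
    have := hmin i (by omega)
    have h2 : (2 : ℝ) ^ i ≤ ε⁻¹ := by
      rw [le_inv_comm₀ (by positivity) h0, le_inv_comm₀ h0 (by positivity)]
      rw [← one_div, le_div_iff₀ h0]
      linarith
    rw [pow_succ]
    linarith
  have g3 : (2 : ℝ) ^ j ≤ G := by
    calc (2 : ℝ) ^ j ≤ 2 * ε⁻¹ := hQε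
      _ ≤ ε⁻¹ ^ 2 := by nlinarith
      _ ≤ ε⁻¹ ^ (2 * I.k) := pow_le_pow_right₀ (by linarith) (by omega)
      _ ≤ G := inv_pow_le_paramBound hk hl h0
  have hR : ((I.maxLen (2 ^ j) ^ I.k : ℕ) : ℝ) ≤ 2 * G :=
    BMInstance.maxLen_pow_le h0 h1 Nat.one_le_two_pow (by push_cast; exact hQε)
  -- `2 ^ size R ≤ 2 * R ≤ 4 * G ≤ G ^ 2`, the last because `4 ≤ G`.
  have hRs : (2 : ℝ) ^ (I.maxLen (2 ^ j) ^ I.k).size ≤ G ^ 2 := by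
    set R := I.maxLen (2 ^ j) ^ I.k with hRdef
    have hR1 : 0 < R := pow_pos (BMInstance.maxLen_pos _) _
    have h2 : 2 ^ R.size ≤ 2 * R := by
      have h3 : 0 < R.size := Nat.size_pos.2 hR1
      have h4 : 2 ^ (R.size - 1) ≤ R := by
        by_contra hlt
        have := Nat.size_le.2 (not_le.1 hlt)
        omega
      calc 2 ^ R.size = 2 * 2 ^ (R.size - 1) := by
            rw [← pow_succ']
            congr 1
            omega
        _ ≤ 2 * R := by omega
    have h3 : (2 : ℝ) ^ R.size ≤ 2 * (R : ℝ) := by exact_mod_cast h2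
    nlinarith
  have y1 : 1 ≤ y := by
    have h2 : (2 : ℝ) ^ 2 ≤ G := by linarith
    have := le_log_of_two_pow_le h2
    push_cast at this
    linarith
  have b1 : 2 * (I.k : ℝ) ≤ 1.5 * y := by exact_mod_cast le_log_of_two_pow_le g1
  have b2 : (I.ℓ : ℝ) ≤ 1.5 * y := le_log_of_two_pow_le g2
  have b3 : (j : ℝ) ≤ 1.5 * y := le_log_of_two_pow_le g3
  have b4 : (((I.maxLen (2 ^ j) ^ I.k).size : ℕ) : ℝ) ≤ 3 * y := by
    have := le_log_of_two_pow_le hRs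
    rw [Real.log_pow] at this
    push_cast at this
    linarith
  have hzy : z ≤ z * y ^ 2 := le_mul_of_one_le_right (by linarith) (one_le_pow₀ y1)
  have hyy : y ≤ y ^ 2 := le_self_pow₀ y1 (by norm_num)
  have hyz : y ^ 2 ≤ z * y ^ 2 := le_mul_of_one_le_left (by positivity) hz1
  -- The most demanding quantity is the length of `numBound`, at most `z + 4 + 3 * y ≤ 8 * (z * y ^
  -- 2)`. Rounding up costs at most one further `z * y ^ 2`.
  set W := ⌈9 * (z * y ^ 2)⌉₊ with hW
  have toW : ∀ a : ℕ, (a : ℝ) ≤ 9 * (z * y ^ 2) → a ≤ W := fun a ha => by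
    exact_mod_cast ha.trans (Nat.le_ceil _)
  have hWle : (W : ℝ) ≤ 10 * (z * y ^ 2) := by
    have := Nat.ceil_lt_add_one (show 0 ≤ 9 * (z * y ^ 2) by positivity)
    rw [← hW] at this
    linarith
  have wn : I.n ≤ W := toW _ (by
    have : (I.n : ℝ) ≤ z := by
      rw [hz]
      exact_mod_cast (show I.n ≤ I.size by unfold BMInstance.size; omega)
    linarith)
  have ws : I.s + 1 ≤ W := toW _ (by
    have : ((I.s + 1 : ℕ) : ℝ) ≤ 2 * z := by
      rw [hz]
      have := I.one_le_size
      exact_mod_cast (show I.s + 1 ≤ 2 * I.size by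
        have : I.s ≤ I.size := by unfold BMInstance.size; omega
        omega)
    linarith)
  have wk : I.k ≤ W := toW _ (by linarith)
  have wd : I.depth ≤ W := toW _ (by
    have h2 : I.depth ≤ I.k * I.ℓ := by
      have : (I.k - 1) * I.ℓ + I.ℓ = I.k * I.ℓ := by
        rw [← Nat.succ_mul]
        congr 1
        omega
      unfold BMInstance.depth
      omega
    have h3 : (I.depth : ℝ) ≤ I.k * I.ℓ := by exact_mod_cast h2
    have h4 : (I.k : ℝ) * I.ℓ ≤ (1.5 * y) * (1.5 * y) :=
      mul_le_mul (by linarith) b2 (by positivity) (by positivity)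
    nlinarith)
  have wj : j ≤ W := toW _ (by linarith)
  have wV : (I.numBound (2 ^ j)).size ≤ W := toW _ (by
    have h2 : (((I.numBound (2 ^ j)).size : ℕ) : ℝ) ≤
        ((I.size + 4 + (I.maxLen (2 ^ j) ^ I.k).size : ℕ) : ℝ) := by
      exact_mod_cast I.size_numBound_le (2 ^ j)
    push_cast at h2 b4
    linarith)
  have hnat := Nat.mul_le_mul (BMInstance.steps_le (Q := 2 ^ j) wn ws wk wd wj)
    (BMInstance.unitCost_le (I := I) wn wV wj (by omega))
  have hfin : (152 * (I.maxLen (2 ^ j) ^ I.k * W ^ 5)) * (4003 * W) =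
      152 * 4003 * (I.maxLen (2 ^ j) ^ I.k * W ^ 6) := by ring
  rw [hfin] at hnat
  calc _ ≤ ((152 * 4003 * (I.maxLen (2 ^ j) ^ I.k * W ^ 6) : ℕ) : ℝ) := by exact_mod_cast hnat
    _ = 152 * 4003 * (((I.maxLen (2 ^ j) ^ I.k : ℕ) : ℝ) * (W : ℝ) ^ 6) := by push_cast; ring
    _ ≤ 152 * 4003 * ((2 * G) * (10 * (z * y ^ 2)) ^ 6) := by gcongr
    _ = timeBound (152 * 4003 * 2 * 10 ^ 6) 6 3 12 I ε := by
      unfold timeBound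
      rw [← hG, ← hy, ← hz]
      push_cast
      ring

/-- With `Q = 2 ^ j` and `e₀` the most profitable element of an optimal `S`, `Q * OPT ≤ Q * best + p
e₀ ≤ Q * best + OPT`. Now `OPT ≤ ε * Q * OPT`, as `1 ≤ ε * Q`. -/
theorem schemeP_approximates (I : BMInstance) {ε : ℝ} (h0 : 0 < ε) (h1 : ε < 1 / 2) :
    Approximates schemeP I ε I.IsSolution (timeBound (152 * 4003 * 2 * 10 ^ 6) 6 3 12 I ε) := by
  classical
  obtain ⟨j, hj, hge, hmin⟩ := exists_first_digit h0 h1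
  obtain ⟨t, σ, hrun, ht, -, hH, hN⟩ := schemeP_spec hj hge hmin h0 (I.enough_numBound (2 ^ j))
    (le_refl j) (I.enough_numBound (2 ^ j)).bdd_init
  refine ⟨t, σ, hrun, le_trans (by exact_mod_cast ht) (time_le I h0 h1 hj hmin), hH.1, ?_⟩
  rw [hH.2]
  -- An optimum of `0` is split off because the choice of `e₀` needs a nonempty optimal solution.
  rcases Nat.eq_zero_or_pos (opt I.p I.IsSolution) with hz | hz
  · rw [hz]
    simp
  have hne : (Finset.univ.filter I.IsSolution).Nonempty := ⟨_, by simpa using hH.1⟩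
  obtain ⟨S, hS, hopt⟩ := Finset.exists_mem_eq_sup _ hne fun S => ∑ e ∈ S, I.p e
  have hoptS : opt I.p I.IsSolution = ∑ e ∈ S, I.p e := by
    rw [← hopt]
    unfold opt
    congr
  rw [Finset.mem_filter] at hS
  have hSne : S.Nonempty := by
    rw [Finset.nonempty_iff_ne_empty]
    rintro rfl
    simp [hoptS] at hz
  obtain ⟨e₀, he₀, hmax⟩ := Finset.exists_max_image S I.p hSne
  have h2 := hN e₀ S hS.2 hSne hmax
  have h3 : I.p e₀ ≤ ∑ e ∈ S, I.p e :=
    Finset.single_le_sum (f := I.p) (fun _ _ => Nat.zero_le _) he₀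
  rw [← hoptS] at h2 h3
  have h4 : (2 ^ j : ℝ) * opt I.p I.IsSolution ≤
      2 ^ j * (σ.reg rBest : ℝ) + opt I.p I.IsSolution := by
    exact_mod_cast h2.trans (by omega)
  have h5 : (0 : ℝ) ≤ opt I.p I.IsSolution := Nat.cast_nonneg _
  have h6 : (2 ^ j : ℝ) * ((1 - ε) * opt I.p I.IsSolution) ≤ 2 ^ j * (σ.reg rBest : ℝ) := by
    nlinarith
  exact le_of_mul_le_mul_left h6 (by positivity)

/-! ### Matroid intersection and dimensional matching as special cases -/

theorem BMIInstance.isSolution_eq (J : BMIInstance) :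
    J.toBM.IsSolution = J.IsSolution := by
  funext S
  simp [BMInstance.IsSolution, BMInstance.IsFeasible, BMIInstance.IsSolution, J.ground]

/-- Independence in the pullback of a free matroid along a coordinate is injectivity of that
coordinate on the set. -/
theorem BDMInstance.isSolution_eq (J : BDMInstance) :
    J.toBMI.IsSolution = J.IsSolution := by
  funext S
  have : (∀ i, (J.partitionMatroid i).Indep (S : Set (Fin J.n))) ↔
      ∀ e ∈ S, ∀ f ∈ S, e ≠ f → ∀ i, J.tuple e i ≠ J.tuple f i := by
    simp only [BDMInstance.partitionMatroid, Matroid.comap_indep_iff, Matroid.freeOn_indep_iff,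
      Set.subset_univ, true_and]
    exact ⟨fun h e he f hf hne i heq => hne (h i he hf heq),
      fun h i e he f hf heq => by_contra fun hne => h e he f hf hne i heq⟩
  simp only [BMIInstance.IsSolution, BDMInstance.IsSolution, this]

end BudgetedMatchoid

theorem mainTheorem1 :
    ∃ (P : BudgetedMatchoid.Prog) (α β γ δ : ℕ),
      (∀ (I : BudgetedMatchoid.BMInstance) (ε : ℝ), 0 < ε → ε < 1 / 2 →
        BudgetedMatchoid.Approximates P I ε I.IsSolution
          (BudgetedMatchoid.timeBound α β γ δ I ε)) ∧
      (∀ (J : BudgetedMatchoid.BMIInstance) (ε : ℝ), 0 < ε → ε < 1 / 2 →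
        BudgetedMatchoid.Approximates P J.toBM ε J.IsSolution
          (BudgetedMatchoid.timeBound α β γ δ J.toBM ε)) ∧
      (∀ (J : BudgetedMatchoid.BDMInstance) (ε : ℝ), 0 < ε → ε < 1 / 2 →
        BudgetedMatchoid.Approximates P J.toBMI.toBM ε J.IsSolution
          (BudgetedMatchoid.timeBound α β γ δ J.toBMI.toBM ε)) := by
  refine ⟨BudgetedMatchoid.schemeP, 152 * 4003 * 2 * 10 ^ 6, 6, 3, 12,
    fun I ε h0 h1 => BudgetedMatchoid.schemeP_approximates I h0 h1, fun J ε h0 h1 => ?_,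
    fun J ε h0 h1 => ?_⟩
  · rw [← J.isSolution_eq]
    exact BudgetedMatchoid.schemeP_approximates J.toBM h0 h1
  · rw [← J.isSolution_eq, ← J.toBMI.isSolution_eq]
    exact BudgetedMatchoid.schemeP_approximates J.toBMI.toBM h0 h1
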